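/- Let $M$ be a compact smooth Riemannian manifold with Riemannian distance $d$, let $A\subset\mathbb R^k$ be compact, let $U\subset\mathbb R^m$ be compact and convex, and let $\mathcal U=L^\infty(\mathbb R,U)$ be equipped with a metric inducing the weak$^*$-topology of $L^\infty(\mathbb R,\mathbb R^m)=L^1(\mathbb R,\mathbb R^m)^*$. Let $f_0,\dots,f_m:A\times M\to TM$ be parameter-dependent vector fields which are $C^\infty$ in $(\alpha,x)$, and consider for $\alpha\in A$ the control-affine system $$\Sigma^\alpha:\quad \dot x(t)=f_0(\alpha,x(t))+\sum_{i=1}^m u_i(t)f_i(\alpha,x(t)),\qquad u\in\mathcal U,$$ all of whose solutions are assumed to be defined on $\mathbb R$. Let $\varphi^\alpha(t,x,u)$ be its transition map, $\theta_tu=u(t+\cdot)$, and $\Phi^\alpha_t(u,x)=(\theta_tu,\varphi^\alpha(t,x,u))$ its control flow on $\mathcal U\times M$ (with the maximum metric). A chain control set of $\Sigma^\alpha$ is a set $E\subset M$ which is maximal with respect to inclusion among the sets such that (i) for each $x\in E$ there is $u\in\mathcal U$ with $\varphi^\alpha(\mathbb R,x,u)\subset E$, and (ii) for all $x,y\in E$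 and $\varepsilon,T>0$ there are $n\ge1$, $u_0,\dots,u_{n-1}\in\mathcal U$, $x=x_0,x_1,\dots,x_n=y$ in $M$ and $t_0,\dots,t_{n-1}\ge T$ with $d(\varphi^\alpha(t_i,x_i,u_i),x_{i+1})<\varepsilon$ for $0\le i<n$. Its lift is $\mathcal E=\{(u,x)\in\mathcal U\times M:\varphi^\alpha(\mathbb R,x,u)\subset E\}$. An additive cocycle for $\Phi^\alpha$ over $\mathcal E$ is a continuous map $\gamma:\mathbb R\times\mathcal E\to\mathbb R$ with $\gamma_{t+s}(z)=\gamma_t(z)+\gamma_s(\Phi^\alpha_t(z))$ for all $t,s\in\mathbb R$, $z\in\mathcal E$. Its Morse spectrum $\Sigma_{Mo}(\gamma,\mathcal E)$ is the intersection over all $\varepsilon,T>0$ of the closures of the sets of all numbers $$\Bigl(\sum_{i=0}^{n-1}T_i\Bigr)^{-1}\sum_{i=0}^{n-1}\gamma_{T_i}(z_i),$$ where $n\ge1$, $z_0,\dots,z_n\in\mathcal E$, $T_0,\dots,T_{n-1}\ge T$, and the distance of $\Phi^\alpha_{T_i}(z_i)$ and $z_{i+1}$ is less than $\varepsilon$ for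 $0\le i<n$. A map $F$ from a metric space $X$ to the nonempty subsets of a metric space $Y$ is called upper semicontinuous at $x_0$ if for every $\varepsilon>0$ there is $\delta>0$ such that $d(x,x_0)<\delta$ implies $\sup_{y\in F(x)}\operatorname{dist}(y,F(x_0))<\varepsilon$; moreover $\limsup_{x\to x_0}F(x)$ denotes the set of all limits of convergent sequences $y_k\in F(x_k)$ with $x_k\to x_0$. **Proposition.** For each $\alpha\in A$ let $E^\alpha$ be a nonempty compact chain control set of $\Sigma^\alpha$ with lift $\mathcal E^\alpha$, such that $\alpha\mapsto E^\alpha$ is upper semicontinuous at some $\alpha^0\in A$. For each $\alpha\in A$ let $\gamma^\alpha$ be an additive cocycle for $\Phi^\alpha$ over $\mathcal E^\alpha$, such that the map $(t,\alpha,u,x)\mapsto\gamma^\alpha_t(u,x)$, defined for $t\in\mathbb R$, $\alpha\in A$, $(u,x)\in\mathcal E^\alpha$, is continuous at every point of $\mathbb R\times\{\alpha^0\}\times\mathcal E^{\alpha^0}$. Then the Morse spectra $\Sigma_{Mo}(\gamma^\alpha,\mathcal E^\alpha)$ are nonempty and compact, the set-valued map $\alpha\mapsto\Sigma_{Mo}(\gamma^\alpha,\mathcal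 E^\alpha)$ is upper semicontinuous at $\alpha^0$, $$\limsup_{\alpha\to\alpha^0}\Sigma_{Mo}(\gamma^\alpha,\mathcal E^\alpha)\subset\Sigma_{Mo}(\gamma^{\alpha^0},\mathcal E^{\alpha^0}),$$ and the real-valued map $\alpha\mapsto\inf\Sigma_{Mo}(\gamma^\alpha,\mathcal E^\alpha)$ is lower semicontinuous at $\alpha^0$. -/

import Mathlib

open Set Filter MeasureTheory Bundle
open scoped Manifold ContDiff Topology ENNReal

noncomputable section

namespace ControlAffine

/-! ### Admissible control functions -/

/-- An element of `L^∞(ℝ, U)`: an (a.e. class of an) essentially bounded measurable function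
`ℝ → ℝ^m` with values in `U` almost everywhere. -/
structure ControlFunction {m : ℕ} (U : Set (EuclideanSpace ℝ (Fin m))) where
  toLp : Lp (EuclideanSpace ℝ (Fin m)) ∞ (volume : Measure ℝ)
  ae_mem : ∀ᵐ t : ℝ, toLp t ∈ U

/-- The weak* topology of `L^∞(ℝ, ℝ^m) = L^1(ℝ, ℝ^m)^*`, restricted to the admissible controls:
the coarsest topology for which all pairings `u ↦ ∫ ⟪u(t), g(t)⟫ dt`, `g ∈ L^1`, are
continuous. -/
@[reducible] def weakStarTopology {m : ℕ} (U : Set (EuclideanSpace ℝ (Fin m))) :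
    TopologicalSpace (ControlFunction U) :=
  TopologicalSpace.induced
    (fun (u : ControlFunction U) (g : Lp (EuclideanSpace ℝ (Fin m)) 1 (volume : Measure ℝ)) =>
      ∫ t : ℝ, inner ℝ (u.toLp t) (g t))
    inferInstance

/-- The shift `θ_t u = u(t + ·)`. -/
def shift {m : ℕ} {U : Set (EuclideanSpace ℝ (Fin m))} (t : ℝ) (u : ControlFunction U) :
    ControlFunction U where
  toLp := Lp.compMeasurePreserving (fun s : ℝ => t + s)
    (measurePreserving_add_left (volume : Measure ℝ) t) u.toLp
  ae_mem := by
    have h := Lp.coeFn_compMeasurePreserving u.toLp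
      (measurePreserving_add_left (volume : Measure ℝ) t)
    have h' := (measurePreserving_add_left (volume : Measure ℝ) t).quasiMeasurePreserving.ae
      u.ae_mem
    filter_upwards [h, h'] with s hs hs'
    rw [hs]
    exact hs'

/-! ### Control-affine systems and their transition maps -/

section System

variable {n m : ℕ} {M : Type*} [TopologicalSpace M] [ChartedSpace (EuclideanSpace ℝ (Fin n)) M]
  {U : Set (EuclideanSpace ℝ (Fin m))}

/-- `c : ℝ → M` is a (Carathéodory) solution on `ℝ` of
`c'(t) = f₀(c(t)) + ∑ i, u_i(t) f_i(c(t))`: it is locally absolutely continuous (tested with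
smooth functions) and satisfies the equation for almost every `t`. -/
structure IsSolution (f₀ : (x : M) → TangentSpace (𝓡 n) x)
    (f : Fin m → (x : M) → TangentSpace (𝓡 n) x) (u : ControlFunction U) (c : ℝ → M) : Prop where
  continuous : Continuous c
  absolutelyContinuous : ∀ g : M → ℝ, ContMDiff (𝓡 n) 𝓘(ℝ, ℝ) ∞ g →
    ∀ a b : ℝ, AbsolutelyContinuousOnInterval (fun t => g (c t)) a b
  hasMFDerivAt : ∀ᵐ t : ℝ, HasMFDerivAt 𝓘(ℝ, ℝ) (𝓡 n) c t
    ((1 : ℝ →L[ℝ] ℝ).smulRight (f₀ (c t) + ∑ i, u.toLp t i • f i (c t)))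

/-- All solutions are defined on `ℝ`: for each initial value and each control there is a solution
on the whole real line. -/
def IsCompleteSystem (U : Set (EuclideanSpace ℝ (Fin m))) (f₀ : (x : M) → TangentSpace (𝓡 n) x)
    (f : Fin m → (x : M) → TangentSpace (𝓡 n) x) : Prop :=
  ∀ (x : M) (u : ControlFunction U), ∃ c : ℝ → M, IsSolution f₀ f u c ∧ c 0 = x

open Classical in
/-- The transition map `φ(t, x, u)`: the value at time `t` of the solution for the control `u`
which starts in `x` at time `0` (and `x` if there is no such solution on `ℝ`). -/
def transitionMap (f₀ : (x : M) → TangentSpace (𝓡 n) x)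
    (f : Fin m → (x : M) → TangentSpace (𝓡 n) x) (t : ℝ) (x : M) (u : ControlFunction U) : M :=
  if h : ∃ c : ℝ → M, IsSolution f₀ f u c ∧ c 0 = x then h.choose t else x

/-- The control flow `Φ_t(u, x) = (θ_t u, φ(t, x, u))`. -/
def controlFlow (f₀ : (x : M) → TangentSpace (𝓡 n) x)
    (f : Fin m → (x : M) → TangentSpace (𝓡 n) x) (t : ℝ) (z : ControlFunction U × M) :
    ControlFunction U × M :=
  (shift t z.1, transitionMap f₀ f t z.2 z.1)

end System

/-! ### Chain control sets -/

section ChainControl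

variable {M 𝒰 : Type*} [MetricSpace M]

/-- Each point of `E` can be kept in `E` for all (positive and negative) times. -/
def IsFullTimeControlledInvariant (φ : ℝ → M → 𝒰 → M) (E : Set M) : Prop :=
  ∀ x ∈ E, ∃ u : 𝒰, ∀ t : ℝ, φ t x u ∈ E

/-- Any two points of `E` are joined by controlled `(ε, T)`-chains for all `ε, T > 0`. -/
def IsChainControllable (φ : ℝ → M → 𝒰 → M) (E : Set M) : Prop :=
  ∀ x ∈ E, ∀ y ∈ E, ∀ ε > (0 : ℝ), ∀ T > (0 : ℝ),
    ∃ N : ℕ, 0 < N ∧ ∃ (u : ℕ → 𝒰) (p : ℕ → M) (τ : ℕ → ℝ), p 0 = x ∧ p N = y ∧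
      ∀ i < N, T ≤ τ i ∧ dist (φ (τ i) (p i) (u i)) (p (i + 1)) < ε

/-- A chain control set: a maximal set (with respect to inclusion) which is full-time controlled
invariant and chain controllable. -/
def IsChainControlSet (φ : ℝ → M → 𝒰 → M) (E : Set M) : Prop :=
  Maximal (fun F : Set M => IsFullTimeControlledInvariant φ F ∧ IsChainControllable φ F) E

/-- The lift `{(u, x) : φ(ℝ, x, u) ⊆ E}` of `E`. -/
def controlLift (φ : ℝ → M → 𝒰 → M) (E : Set M) : Set (𝒰 × M) :=
  {z | ∀ t : ℝ, φ t z.2 z.1 ∈ E}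

end ChainControl

/-! ### Cocycles and the Morse spectrum -/

section Morse

variable {X : Type*} [MetricSpace X]

/-- `γ` is an additive cocycle over `B` for the flow `Φ`. Only the values of `γ` on `ℝ × B`
matter. -/
structure IsAdditiveCocycle (Φ : ℝ → X → X) (B : Set X) (γ : ℝ → X → ℝ) : Prop where
  continuousOn : ContinuousOn (fun p : ℝ × X => γ p.1 p.2) (univ ×ˢ B)
  add : ∀ t s : ℝ, ∀ x ∈ B, γ (t + s) x = γ t x + γ s (Φ t x)

/-- The points `p 0, …, p N` and times `τ 0, …, τ (N - 1)` form an `(ε, T)`-chain in `B` for the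
flow `Φ`. -/
def IsMorseChain (Φ : ℝ → X → X) (B : Set X) (ε T : ℝ) (N : ℕ) (p : ℕ → X) (τ : ℕ → ℝ) : Prop :=
  0 < N ∧ (∀ i ≤ N, p i ∈ B) ∧ ∀ i < N, T ≤ τ i ∧ dist (Φ (τ i) (p i)) (p (i + 1)) < ε

/-- The Morse exponent of a chain. -/
def morseExponent (γ : ℝ → X → ℝ) (N : ℕ) (p : ℕ → X) (τ : ℕ → ℝ) : ℝ :=
  (∑ i ∈ Finset.range N, γ (τ i) (p i)) / ∑ i ∈ Finset.range N, τ i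

/-- The Morse spectrum of `γ` over `B`: the intersection over all `ε, T > 0` of the closures of
the sets of Morse exponents of `(ε, T)`-chains in `B`. -/
def morseSpectrum (Φ : ℝ → X → X) (B : Set X) (γ : ℝ → X → ℝ) : Set ℝ :=
  ⋂ (ε : ℝ) (_ : 0 < ε) (T : ℝ) (_ : 0 < T),
    closure {l : ℝ | ∃ (N : ℕ) (p : ℕ → X) (τ : ℕ → ℝ),
      IsMorseChain Φ B ε T N p τ ∧ l = morseExponent γ N p τ}

end Morse

/-! ### Semicontinuity of set-valued maps -/

section SetValued

variable {X Y : Type*} [MetricSpace X] [MetricSpace Y]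

/-- Upper semicontinuity of a set-valued map at `x₀`: for each `ε > 0` there is `δ > 0` such that
`d(x, x₀) < δ` implies `sup_{y ∈ F(x)} dist(y, F(x₀)) < ε`. -/
def SetUpperSemicontinuousAt (F : X → Set Y) (x₀ : X) : Prop :=
  ∀ ε > (0 : ℝ), ∃ δ > (0 : ℝ), ∀ x : X, dist x x₀ < δ →
    (⨆ y ∈ F x, Metric.infEDist y (F x₀)) < ENNReal.ofReal ε

/-- The upper limit of a set-valued map at `x₀`: all limits of sequences `y_k ∈ F(x_k)` with
`x_k → x₀`. -/
def setLimsup (F : X → Set Y) (x₀ : X) : Set Y :=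
  {y | ∃ (xs : ℕ → X) (ys : ℕ → Y), Tendsto xs atTop (𝓝 x₀) ∧ (∀ k, ys k ∈ F (xs k)) ∧
    Tendsto ys atTop (𝓝 y)}

end SetValued

end ControlAffine

end

open ControlAffine

/-!
The Morse spectrum depends on the flow only through chains whose times are long, and every long
step of such a chain can be cut along its orbit into steps of duration in `[T, 2T]`
(`exists_shortSteps_of_mem_morseExponents`). On this compact time interval everything is uniformly
continuous near the lift `ℰ⁰` over `α⁰`: the flows and the cocycles for `α` close to `α⁰`, evaluated
at a point of the lift `ℰ^α`, are close to those for `α⁰` at any nearby point of `ℰ⁰`. Since the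
lifts are upper semicontinuous, each point of a chain in `ℰ^α` can be moved to a nearby point of
`ℰ⁰`; the result is a chain for `α⁰` with slightly larger jumps and almost the same exponent
(`eventually_morseExponents_subset_thickening`). As the Morse spectrum is the intersection of a
decreasing sequence of compact sets of exponents, it is nonempty and compact, and upper
semicontinuity follows; the statements on the upper limit and on the infimum are consequences of
upper semicontinuity and compactness. Of the chain control sets only compactness, nonemptiness and
full-time controlled invariance enter.

This requires that the control flows are flows on a compact space, continuous jointly in time,
parameter and state.

* The space of controls is compact in the weak* topology. The `L¹`–`L^∞` duality is replaced by
  Hilbert space duality: for a Gaussian measure, which is finite and equivalent to Lebesgue measure,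
  the controls form a bounded closed convex subset of `L²`, hence a weakly compact one, and the
  functions that are represented by `L²` are dense in `L¹` (`compactSpace_controlFunction`).
* The compact manifold is embedded into a Euclidean space by a map `e`. A Carathéodory solution `c`
  then satisfies an integral equation for `e ∘ c`, by the fundamental theorem of calculus for
  absolutely continuous functions. Smooth functions on `M` are Lipschitz with respect to
  `‖e x - e y‖` (`exists_norm_sub_le_of_embedding`), so Gronwall's inequality yields uniqueness, hence
  the flow property, as well as continuous dependence (`IsIntegralSolution.norm_sub_le`,
  `continuous_of_isIntegralSolution`). The dependence on the control is weak* continuous because the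
  control enters affinely: along the fixed reference solution, the difference of the right-hand
  sides is a pairing of the controls with an integrable function.
-/

open ControlAffine

namespace ControlAffine

/-! ### Morse exponents of chains over an invariant set -/

section MorseSpectrum

variable {X : Type*} [MetricSpace X] {Φ : ℝ → X → X} {B : Set X} {γ : ℝ → X → ℝ}

/-- The Morse exponents of all `(ε, T)`-chains in `B`; the Morse spectrum is the intersection of
the closures of these sets. -/
def morseExponents (Φ : ℝ → X → X) (B : Set X) (γ : ℝ → X → ℝ) (ε T : ℝ) : Set ℝ :=
  {l : ℝ | ∃ (N : ℕ) (p : ℕ → X) (τ : ℕ → ℝ),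
      IsMorseChain Φ B ε T N p τ ∧ l = morseExponent γ N p τ}

theorem mem_morseSpectrum_iff {l : ℝ} : l ∈ morseSpectrum Φ B γ ↔
    ∀ ε > 0, ∀ T > 0, l ∈ closure (morseExponents Φ B γ ε T) := by
  simp [morseSpectrum, morseExponents]

theorem morseExponents_mono {ε ε' T T' : ℝ} (hε : ε ≤ ε') (hT : T' ≤ T) :
    morseExponents Φ B γ ε T ⊆ morseExponents Φ B γ ε' T' := by
  rintro l ⟨N, p, τ, ⟨hN, hp, hτ⟩, rfl⟩
  exact ⟨N, p, τ, ⟨hN, hp, fun i hi => ⟨hT.trans (hτ i hi).1, (hτ i hi).2.trans_le hε⟩⟩, rfl⟩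

/-- `x` is the end point of a (possibly trivial) chain in `B` whose times lie in `[T, 2T]`, with
accumulated cocycle value `g` and accumulated time `s`. -/
def ReachedByShortSteps (Φ : ℝ → X → X) (B : Set X) (γ : ℝ → X → ℝ) (ε T : ℝ)
    (x : X) (g s : ℝ) : Prop :=
  ∃ (N : ℕ) (p : ℕ → X) (τ : ℕ → ℝ), (∀ i ≤ N, p i ∈ B) ∧
    (∀ i < N, T ≤ τ i ∧ τ i ≤ 2 * T ∧ dist (Φ (τ i) (p i)) (p (i + 1)) < ε) ∧ p N = x ∧
    ∑ i ∈ Finset.range N, γ (τ i) (p i) = g ∧ ∑ i ∈ Finset.range N, τ i = s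

theorem ReachedByShortSteps.mem {ε T : ℝ} {x : X} {g s : ℝ}
    (h : ReachedByShortSteps Φ B γ ε T x g s) : x ∈ B := by
  obtain ⟨N, p, τ, hp, -, rfl, -⟩ := h
  exact hp N le_rfl

theorem ReachedByShortSteps.refl {ε T : ℝ} {x : X} (hx : x ∈ B) :
    ReachedByShortSteps Φ B γ ε T x 0 0 :=
  ⟨0, fun _ => x, fun _ => 0, fun _ _ => hx, by simp, rfl, by simp, by simp⟩

theorem ReachedByShortSteps.snoc {ε T : ℝ} {x y : X} {g s t : ℝ}
    (h : ReachedByShortSteps Φ B γ ε T x g s) (ht : T ≤ t) (ht' : t ≤ 2 * T) (hy : y ∈ B)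
    (hxy : dist (Φ t x) y < ε) : ReachedByShortSteps Φ B γ ε T y (g + γ t x) (s + t) := by
  obtain ⟨N, p, τ, hp, hτ, rfl, rfl, rfl⟩ := h
  refine ⟨N + 1, fun i => if i ≤ N then p i else y, fun i => if i < N then τ i else t,
    fun i _ => ?_, fun i hi => ?_, by simp, ?_, ?_⟩
  · dsimp only
    split_ifs with h
    exacts [hp i h, hy]
  · rcases (Nat.lt_succ_iff.1 hi).lt_or_eq with h | rfl
    · have h1 : i ≤ N := h.le
      have h2 : i + 1 ≤ N := h
      simpa [h, h1, h2] using hτ i h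
    · simpa using ⟨ht, ht', hxy⟩
  · rw [Finset.sum_range_succ]
    simp only [le_refl, lt_self_iff_false, if_true, if_false]
    congr 1
    refine Finset.sum_congr rfl fun i hi => ?_
    have := Finset.mem_range.1 hi
    simp [this, this.le]
  · rw [Finset.sum_range_succ]
    simp only [lt_self_iff_false, if_false]
    congr 1
    refine Finset.sum_congr rfl fun i hi => ?_
    simp [Finset.mem_range.1 hi]

/-- A long step is split into steps of duration `T` along the orbit, without jumps, and a last
step of duration in `[T, 2T]`. -/
theorem ReachedByShortSteps.append {ε T : ℝ} (hε : 0 < ε) (hT : 0 < T)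
    (hinv : ∀ t, MapsTo (Φ t) B B) (hadd : ∀ t s, ∀ z ∈ B, Φ (t + s) z = Φ s (Φ t z))
    (hγ : ∀ t s, ∀ z ∈ B, γ (t + s) z = γ t z + γ s (Φ t z)) {x y : X} {g s t : ℝ}
    (h : ReachedByShortSteps Φ B γ ε T x g s) (ht : T ≤ t) (hy : y ∈ B)
    (hxy : dist (Φ t x) y < ε) : ReachedByShortSteps Φ B γ ε T y (g + γ t x) (s + t) := by
  obtain ⟨n, hn⟩ := exists_nat_ge (t / T)
  rw [div_le_iff₀ hT] at hn
  induction n generalizing x g s t with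
  | zero => norm_num at hn; linarith
  | succ n ih =>
    by_cases h2 : t ≤ 2 * T
    · exact h.snoc ht h2 hy hxy
    · have hx := h.mem
      have h1 := h.snoc le_rfl (by linarith) (hinv T hx) (by simpa using hε)
      have h3 := ih (t := t - T) h1 (by linarith)
        (by rw [← hadd _ _ _ hx]; simpa using hxy) (by push_cast at hn; linarith)
      rw [add_assoc, ← hγ _ _ _ hx, add_assoc] at h3
      simpa using h3

/-- Every exponent of an `(ε, T)`-chain is the exponent of one with all times in `[T, 2T]`. -/
theorem exists_shortSteps_of_mem_morseExponents {ε T : ℝ} (hε : 0 < ε) (hT : 0 < T)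
    (hinv : ∀ t, MapsTo (Φ t) B B) (hadd : ∀ t s, ∀ z ∈ B, Φ (t + s) z = Φ s (Φ t z))
    (hγ : ∀ t s, ∀ z ∈ B, γ (t + s) z = γ t z + γ s (Φ t z)) {l : ℝ}
    (hl : l ∈ morseExponents Φ B γ ε T) :
    ∃ (N : ℕ) (p : ℕ → X) (τ : ℕ → ℝ), IsMorseChain Φ B ε T N p τ ∧ (∀ i < N, τ i ≤ 2 * T) ∧
      l = morseExponent γ N p τ := by
  obtain ⟨N, p, τ, ⟨hN, hp, hτ⟩, rfl⟩ := hl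
  have key : ∀ n ≤ N, ReachedByShortSteps Φ B γ ε T (p n)
      (∑ i ∈ Finset.range n, γ (τ i) (p i)) (∑ i ∈ Finset.range n, τ i) := by
    intro n
    induction n with
    | zero => intro _; simpa using ReachedByShortSteps.refl (hp 0 (Nat.zero_le _))
    | succ n ih =>
      intro hn
      rw [Finset.sum_range_succ, Finset.sum_range_succ]
      exact (ih (by omega)).append hε hT hinv hadd hγ (hτ n hn).1 (hp _ hn) (hτ n hn).2
  have hpos : 0 < ∑ i ∈ Finset.range N, τ i :=
    Finset.sum_pos (fun i hi => hT.trans_le (hτ i (Finset.mem_range.1 hi)).1) (by simpa using hN.ne')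
  obtain ⟨N', p', τ', hp', hτ', -, hg, hs⟩ := key N le_rfl
  refine ⟨N', p', τ', ⟨?_, hp', fun i hi => ⟨(hτ' i hi).1, (hτ' i hi).2.2⟩⟩,
    fun i hi => (hτ' i hi).2.1, ?_⟩
  · rcases Nat.eq_zero_or_pos N' with rfl | h
    · simp at hs; linarith
    · exact h
  · rw [morseExponent, morseExponent, hg, hs]

/-- Pointwise deviations of at most `c` over steps of length at least `T` change the quotient of the
sums by at most `c / T`, whatever the number of steps. -/
theorem abs_sum_div_sub_sum_div_le {N : ℕ} {a b τ : ℕ → ℝ} {T c : ℝ} (hN : 0 < N) (hT : 0 < T)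
    (hτ : ∀ i < N, T ≤ τ i) (hab : ∀ i < N, |a i - b i| ≤ c) :
    |(∑ i ∈ Finset.range N, a i) / ∑ i ∈ Finset.range N, τ i -
      (∑ i ∈ Finset.range N, b i) / ∑ i ∈ Finset.range N, τ i| ≤ c / T := by
  have hNr : (0 : ℝ) < N := by exact_mod_cast hN
  have h1 : N * T ≤ ∑ i ∈ Finset.range N, τ i := by
    simpa using Finset.card_nsmul_le_sum (Finset.range N) τ T
      fun i hi => hτ i (Finset.mem_range.1 hi)
  have h2 : |∑ i ∈ Finset.range N, (a i - b i)| ≤ N * c := by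
    refine (Finset.abs_sum_le_sum_abs _ _).trans ?_
    simpa using Finset.sum_le_card_nsmul (Finset.range N) (fun i => |a i - b i|) c
      fun i hi => hab i (Finset.mem_range.1 hi)
  have h3 : 0 < N * T := by positivity
  have hc : 0 ≤ c := (abs_nonneg _).trans (hab 0 hN)
  rw [← sub_div, ← Finset.sum_sub_distrib, abs_div, abs_of_pos (h3.trans_le h1)]
  calc _ ≤ N * c / (N * T) := by gcongr
    _ = c / T := by field_simp

/-- The bound does not depend on `ε`: after refinement of the chain, only the values of the cocycle
on the compact set `[T, 2T] × B` matter. -/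
theorem exists_forall_morseExponents_abs_le (hB : IsCompact B)
    (hinv : ∀ t, MapsTo (Φ t) B B) (hadd : ∀ t s, ∀ z ∈ B, Φ (t + s) z = Φ s (Φ t z))
    (hγ : IsAdditiveCocycle Φ B γ) {T : ℝ} (hT : 0 < T) :
    ∃ C : ℝ, ∀ ε > 0, ∀ l ∈ morseExponents Φ B γ ε T, |l| ≤ C := by
  obtain ⟨C, hC⟩ := ((isCompact_Icc (a := T) (b := 2 * T)).prod hB).exists_bound_of_continuousOn
    (hγ.continuousOn.mono (prod_mono (subset_univ _) Subset.rfl))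
  refine ⟨C / T, fun ε hε l hl => ?_⟩
  obtain ⟨N, p, τ, ⟨hN, hp, hτ⟩, hτ', rfl⟩ :=
    exists_shortSteps_of_mem_morseExponents hε hT hinv hadd hγ.add hl
  simpa [morseExponent] using abs_sum_div_sub_sum_div_le (b := fun _ => 0) hN hT
    (fun i hi => (hτ i hi).1)
    (fun i hi => by simpa using hC (τ i, p i) ⟨⟨(hτ i hi).1, hτ' i hi⟩, hp i hi.le⟩)

theorem morseExponents_nonempty (hinv : ∀ t, MapsTo (Φ t) B B) (hne : B.Nonempty) {ε T : ℝ}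
    (hε : 0 < ε) : (morseExponents Φ B γ ε T).Nonempty := by
  obtain ⟨z, hz⟩ := hne
  refine ⟨_, 1, fun i => if i = 0 then z else Φ T z, fun _ => T, ⟨one_pos, ?_, ?_⟩, rfl⟩
  · intro i _
    dsimp only
    split_ifs
    exacts [hz, hinv T hz]
  · intro i hi
    obtain rfl : i = 0 := by omega
    simpa using hε

/-- The Morse spectrum as the intersection of a decreasing sequence. -/
theorem morseSpectrum_eq_iInter : morseSpectrum Φ B γ =
    ⋂ k : ℕ, closure (morseExponents Φ B γ (1 / ((k : ℝ) + 1)) ((k : ℝ) + 1)) := by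
  ext l
  rw [mem_morseSpectrum_iff, mem_iInter]
  refine ⟨fun h k => h _ (by positivity) _ (by positivity), fun h ε hε T hT => ?_⟩
  obtain ⟨k, hk⟩ := exists_nat_ge (max (1 / ε) T)
  have h1 : 1 / ε ≤ k + 1 := by linarith [le_max_left (1 / ε) T]
  refine closure_mono (morseExponents_mono ?_ ?_) (h k)
  · rw [div_le_iff₀ (by positivity)]
    rw [div_le_iff₀ hε] at h1
    linarith
  · linarith [le_max_right (1 / ε) T]

theorem antitone_closure_morseExponents : Antitone fun k : ℕ =>
    closure (morseExponents Φ B γ (1 / ((k : ℝ) + 1)) ((k : ℝ) + 1)) := by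
  intro k k' h
  have : (k : ℝ) ≤ k' := by exact_mod_cast h
  exact closure_mono (morseExponents_mono (by gcongr) (by gcongr))

theorem isCompact_closure_morseExponents (hB : IsCompact B)
    (hinv : ∀ t, MapsTo (Φ t) B B) (hadd : ∀ t s, ∀ z ∈ B, Φ (t + s) z = Φ s (Φ t z))
    (hγ : IsAdditiveCocycle Φ B γ) {ε T : ℝ} (hε : 0 < ε) (hT : 0 < T) :
    IsCompact (closure (morseExponents Φ B γ ε T)) := by
  obtain ⟨C, hC⟩ := exists_forall_morseExponents_abs_le hB hinv hadd hγ hT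
  exact ((isBounded_iff_forall_norm_le.2 ⟨C, hC ε hε⟩) :
    Bornology.IsBounded (morseExponents Φ B γ ε T)).isCompact_closure

theorem morseSpectrum_nonempty_and_isCompact (hB : IsCompact B) (hne : B.Nonempty)
    (hinv : ∀ t, MapsTo (Φ t) B B) (hadd : ∀ t s, ∀ z ∈ B, Φ (t + s) z = Φ s (Φ t z))
    (hγ : IsAdditiveCocycle Φ B γ) :
    (morseSpectrum Φ B γ).Nonempty ∧ IsCompact (morseSpectrum Φ B γ) := by
  have hc : ∀ k : ℕ, IsCompact
      (closure (morseExponents Φ B γ (1 / ((k : ℝ) + 1)) ((k : ℝ) + 1))) := fun k =>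
    isCompact_closure_morseExponents hB hinv hadd hγ (by positivity) (by positivity)
  rw [morseSpectrum_eq_iInter]
  exact ⟨IsCompact.nonempty_iInter_of_sequence_nonempty_isCompact_isClosed _
    (fun k => antitone_closure_morseExponents k.le_succ)
    (fun k => (morseExponents_nonempty hinv hne (by positivity)).closure) (hc 0)
    (fun k => isClosed_closure), (hc 0).of_isClosed_subset
      (isClosed_iInter fun k => isClosed_closure) (iInter_subset _ 0)⟩

end MorseSpectrum

/-! ### Upper semicontinuity of the Morse spectrum -/

section ParameterDependence

variable {X A : Type*} [MetricSpace X] [MetricSpace A] {Φ : A → ℝ → X → X} {B : A → Set X}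
  {γ : A → ℝ → X → ℝ} {α₀ : A}

/-- Uniform continuity over compact time intervals near `B α₀`. It is obtained by thickening the
compact set of all `(t, α₀, z, z)` with `z ∈ B α₀`. -/
theorem exists_delta_forall_dist_flow_lt_and_cocycle_lt
    (hΦ : Continuous fun p : ℝ × A × X => Φ p.2.1 p.1 p.2.2) (hB : IsCompact (B α₀))
    (hγ : ∀ (t : ℝ), ∀ z ∈ B α₀, ContinuousWithinAt (fun p : ℝ × A × X => γ p.2.1 p.1 p.2.2)
        {p | p.2.2 ∈ B p.2.1} (t, α₀, z)) (T₁ T₂ : ℝ) {ε : ℝ} (hε : 0 < ε) :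
    ∃ δ > 0, ∀ t ∈ Icc T₁ T₂, ∀ α, dist α α₀ < δ → ∀ z ∈ B α, ∀ z' ∈ B α₀, dist z z' < δ →
      dist (Φ α t z) (Φ α₀ t z') < ε ∧ |γ α t z - γ α₀ t z'| < ε := by
  let K : Set (ℝ × A × X × X) := (fun q : ℝ × X => (q.1, α₀, q.2, q.2)) '' (Icc T₁ T₂ ×ˢ B α₀)
  have hK : IsCompact K := (isCompact_Icc.prod hB).image (by fun_prop)
  let W : Set (ℝ × A × X × X) := {q | q.2.2.1 ∈ B q.2.1 → q.2.2.2 ∈ B α₀ →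
    dist (Φ q.2.1 q.1 q.2.2.1) (Φ α₀ q.1 q.2.2.2) < ε ∧
      |γ q.2.1 q.1 q.2.2.1 - γ α₀ q.1 q.2.2.2| < ε}
  have hW : W ∈ 𝓝ˢ K := by
    rw [mem_nhdsSet_iff_forall]
    rintro _ ⟨⟨t, z⟩, ⟨-, hz⟩, rfl⟩
    have h1 : Continuous fun q : ℝ × A × X × X =>
        dist (Φ q.2.1 q.1 q.2.2.1) (Φ α₀ q.1 q.2.2.2) :=
      (hΦ.comp (g := fun p : ℝ × A × X => Φ p.2.1 p.1 p.2.2)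
        (f := fun q : ℝ × A × X × X => (q.1, q.2.1, q.2.2.1)) (by fun_prop)).dist
      (hΦ.comp (g := fun p : ℝ × A × X => Φ p.2.1 p.1 p.2.2)
        (f := fun q : ℝ × A × X × X => (q.1, α₀, q.2.2.2)) (by fun_prop))
    have h2 : ∀ᶠ q in 𝓝 ((t, α₀, z, z) : ℝ × A × X × X),
        dist (Φ q.2.1 q.1 q.2.2.1) (Φ α₀ q.1 q.2.2.2) < ε :=
      h1.continuousAt.eventually_lt continuousAt_const (by simpa using hε)
    have h3 := Metric.tendsto_nhds.1 (hγ t z hz).tendsto (ε / 2) (half_pos hε)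
    rw [eventually_nhdsWithin_iff] at h3
    have c1 : Continuous fun q : ℝ × A × X × X => (q.1, q.2.1, q.2.2.1) := by fun_prop
    have c2 : Continuous fun q : ℝ × A × X × X => (q.1, α₀, q.2.2.2) := by fun_prop
    filter_upwards [h2, (c1.tendsto (t, α₀, z, z)).eventually h3,
      (c2.tendsto (t, α₀, z, z)).eventually h3] with q hq h4 h5 hz1 hz2
    refine ⟨hq, ?_⟩
    have h6 := dist_triangle_right (γ q.2.1 q.1 q.2.2.1) (γ α₀ q.1 q.2.2.2) (γ α₀ t z)
    have h7 := h4 hz1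
    have h8 := h5 hz2
    rw [← Real.dist_eq]
    linarith
  obtain ⟨δ, hδ, hsub⟩ := (Metric.hasBasis_nhdsSet_thickening hK).mem_iff.1 hW
  refine ⟨δ, hδ, fun t ht α hα z hz z' hz' hzz => ?_⟩
  have hmem : (t, α, z, z') ∈ W := by
    refine hsub (Metric.mem_thickening_iff.2 ⟨(t, α₀, z', z'), ⟨(t, z'), ⟨ht, hz'⟩, rfl⟩, ?_⟩)
    simp [Prod.dist_eq, hα, hzz]
  exact hmem hz hz'

/-- Chains of a nearby system over `B α` are shadowed by chains over `B α₀`: replacing every point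
by a nearby point of `B α₀` changes jumps and exponents only slightly, since the times may be taken
in the compact interval `[T, 2T]`. -/
theorem eventually_morseExponents_subset_thickening
    (hΦ : Continuous fun p : ℝ × A × X => Φ p.2.1 p.1 p.2.2) (hB : IsCompact (B α₀))
    (hinv : ∀ α t, MapsTo (Φ α t) (B α) (B α))
    (hadd : ∀ α t s, ∀ z ∈ B α, Φ α (t + s) z = Φ α s (Φ α t z))
    (hγadd : ∀ α, IsAdditiveCocycle (Φ α) (B α) (γ α))
    (hγ : ∀ (t : ℝ), ∀ z ∈ B α₀, ContinuousWithinAt (fun p : ℝ × A × X => γ p.2.1 p.1 p.2.2)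
        {p | p.2.2 ∈ B p.2.1} (t, α₀, z))
    (husc : ∀ δ > 0, ∀ᶠ α in 𝓝 α₀, ∀ z ∈ B α, ∃ z' ∈ B α₀, dist z z' < δ)
    {ε T η : ℝ} (hε : 0 < ε) (hT : 0 < T) (hη : 0 < η) :
    ∀ᶠ α in 𝓝 α₀, morseSpectrum (Φ α) (B α) (γ α) ⊆
      Metric.thickening η (morseExponents (Φ α₀) (B α₀) (γ α₀) ε T) := by
  -- the jumps are made of three parts; the error `η / 3 * T` per step is `η / 3` per unit of time
  have hmin : 0 < min (ε / 3) (η / 3 * T) := by positivity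
  obtain ⟨δ, hδ, h⟩ :=
    exists_delta_forall_dist_flow_lt_and_cocycle_lt hΦ hB hγ T (2 * T) hmin
  filter_upwards [husc (min δ (ε / 3)) (by positivity), Metric.ball_mem_nhds α₀ hδ]
    with α hα hαδ l hl
  obtain ⟨l', hl', hll'⟩ :=
    Metric.mem_closure_iff.1 (mem_morseSpectrum_iff.1 hl (ε / 3) (by positivity) T hT)
      (η / 3) (by positivity)
  obtain ⟨N, p, τ, ⟨hN, hp, hτ⟩, hτ', rfl⟩ := exists_shortSteps_of_mem_morseExponents
    (by positivity) hT (hinv α) (hadd α) (hγadd α).add hl'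
  have hex : ∀ i, ∃ z', i ≤ N → z' ∈ B α₀ ∧ dist (p i) z' < min δ (ε / 3) := fun i => by
    by_cases hi : i ≤ N
    · obtain ⟨z', h1, h2⟩ := hα _ (hp i hi)
      exact ⟨z', fun _ => ⟨h1, h2⟩⟩
    · exact ⟨p i, fun h => absurd h hi⟩
  choose q hq using hex
  have hclose : ∀ i < N, dist (Φ α (τ i) (p i)) (Φ α₀ (τ i) (q i)) < min (ε / 3) (η / 3 * T) ∧
      |γ α (τ i) (p i) - γ α₀ (τ i) (q i)| < min (ε / 3) (η / 3 * T) := fun i hi =>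
    h _ ⟨(hτ i hi).1, hτ' i hi⟩ α hαδ _ (hp i hi.le) _ (hq i hi.le).1
      ((hq i hi.le).2.trans_le (min_le_left _ _))
  refine Metric.mem_thickening_iff.2 ⟨_, ⟨N, q, τ, ⟨hN, fun i hi => (hq i hi).1,
    fun i hi => ⟨(hτ i hi).1, ?_⟩⟩, rfl⟩, ?_⟩
  · have h1 := (hclose i hi).1.trans_le (min_le_left _ _)
    have h2 := (hτ i hi).2
    have h3 := (hq (i + 1) hi).2.trans_le (min_le_right _ _)
    have h4 := dist_triangle4 (Φ α₀ (τ i) (q i)) (Φ α (τ i) (p i)) (p (i + 1)) (q (i + 1))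
    rw [dist_comm (Φ α₀ (τ i) (q i)) (Φ α (τ i) (p i))] at h4
    linarith
  · have h1 : |morseExponent (γ α) N p τ - morseExponent (γ α₀) N q τ| ≤ η / 3 * T / T :=
      abs_sum_div_sub_sum_div_le hN hT (fun i hi => (hτ i hi).1)
        fun i hi => (hclose i hi).2.le.trans (min_le_right _ _)
    rw [mul_div_cancel_right₀ _ hT.ne', ← Real.dist_eq] at h1
    have h2 := dist_triangle l (morseExponent (γ α) N p τ) (morseExponent (γ α₀) N q τ)
    linarith

theorem setUpperSemicontinuousAt_morseSpectrum
    (hΦ : Continuous fun p : ℝ × A × X => Φ p.2.1 p.1 p.2.2) (hB : IsCompact (B α₀))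
    (hinv : ∀ α t, MapsTo (Φ α t) (B α) (B α))
    (hadd : ∀ α t s, ∀ z ∈ B α, Φ α (t + s) z = Φ α s (Φ α t z))
    (hγadd : ∀ α, IsAdditiveCocycle (Φ α) (B α) (γ α))
    (hγ : ∀ (t : ℝ), ∀ z ∈ B α₀, ContinuousWithinAt (fun p : ℝ × A × X => γ p.2.1 p.1 p.2.2)
        {p | p.2.2 ∈ B p.2.1} (t, α₀, z))
    (husc : ∀ δ > 0, ∀ᶠ α in 𝓝 α₀, ∀ z ∈ B α, ∃ z' ∈ B α₀, dist z z' < δ) :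
    SetUpperSemicontinuousAt (fun α => morseSpectrum (Φ α) (B α) (γ α)) α₀ := by
  intro ε hε
  set S := morseSpectrum (Φ α₀) (B α₀) (γ α₀) with hS
  -- one of the compact sets decreasing to the spectrum lies in its `ε / 4`-neighbourhood
  obtain ⟨k, hk⟩ := exists_subset_nhds_of_isCompact'
    (antitone_closure_morseExponents (Φ := Φ α₀) (B := B α₀) (γ := γ α₀)).directed_ge
    (fun k => isCompact_closure_morseExponents hB (hinv α₀) (hadd α₀) (hγadd α₀)
      (by positivity) (by positivity)) (fun k => isClosed_closure)
    (U := Metric.thickening (ε / 4) S) fun x hx => by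
      rw [← morseSpectrum_eq_iInter] at hx
      exact Metric.isOpen_thickening.mem_nhds (Metric.self_subset_thickening (by positivity) _ hx)
  have h1 := eventually_morseExponents_subset_thickening hΦ hB hinv hadd hγadd hγ husc
    (ε := 1 / ((k : ℝ) + 1)) (T := (k : ℝ) + 1) (η := ε / 4) (by positivity) (by positivity)
    (by positivity)
  obtain ⟨δ, hδ, h2⟩ := Metric.eventually_nhds_iff.1 h1
  refine ⟨δ, hδ, fun α hα => ?_⟩
  refine lt_of_le_of_lt (b := ENNReal.ofReal (ε / 2)) (iSup₂_le fun y hy => ?_)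
    ((ENNReal.ofReal_lt_ofReal_iff hε).2 (by linarith))
  obtain ⟨z, hz, hyz⟩ := Metric.mem_thickening_iff.1 (h2 hα hy)
  obtain ⟨w, hw, hzw⟩ := Metric.mem_thickening_iff.1 (hk (subset_closure hz))
  refine (Metric.infEDist_le_edist_of_mem hw).trans ?_
  rw [edist_dist]
  exact ENNReal.ofReal_le_ofReal (by linarith [dist_triangle y z w])

theorem SetUpperSemicontinuousAt.eventually_forall_infEDist_lt {F : A → Set X} {x₀ : A}
    (hF : SetUpperSemicontinuousAt F x₀) {ε : ℝ} (hε : 0 < ε) :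
    ∀ᶠ x in 𝓝 x₀, ∀ y ∈ F x, Metric.infEDist y (F x₀) < ENNReal.ofReal ε := by
  obtain ⟨δ, hδ, h⟩ := hF ε hε
  filter_upwards [Metric.ball_mem_nhds x₀ hδ] with x hx y hy
  exact (le_iSup₂ (f := fun y _ => Metric.infEDist y (F x₀)) y hy).trans_lt (h x hx)

theorem SetUpperSemicontinuousAt.setLimsup_subset {F : A → Set X} {x₀ : A}
    (hF : SetUpperSemicontinuousAt F x₀) (hcl : IsClosed (F x₀)) : setLimsup F x₀ ⊆ F x₀ := by
  rintro y ⟨xs, ys, hxs, hys, hy⟩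
  rw [← hcl.closure_eq, Metric.mem_closure_iff_infEDist_zero]
  refine le_antisymm (ENNReal.le_of_forall_pos_le_add fun ε hε _ => ?_) zero_le
  rw [zero_add]
  refine le_of_tendsto ((Metric.continuous_infEDist.tendsto y).comp hy) ?_
  filter_upwards [hxs.eventually
    (hF.eventually_forall_infEDist_lt (ε := ε) (by exact_mod_cast hε))] with k hk
  simpa using (hk _ (hys k)).le

theorem SetUpperSemicontinuousAt.lowerSemicontinuousAt_sInf {F : A → Set ℝ} {x₀ : A}
    (hF : SetUpperSemicontinuousAt F x₀) (hne : ∀ x, (F x).Nonempty)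
    (hc : ∀ x, IsCompact (F x)) : LowerSemicontinuousAt (fun x => sInf (F x)) x₀ := by
  intro y hy
  filter_upwards [hF.eventually_forall_infEDist_lt (sub_pos.2 hy)] with x hx
  obtain ⟨z, hz, hxz⟩ := Metric.infEDist_lt_iff.1 (hx _ ((hc x).sInf_mem (hne x)))
  rw [edist_dist, ENNReal.ofReal_lt_ofReal_iff (sub_pos.2 hy), Real.dist_eq] at hxz
  have h2 := csInf_le (hc x₀).bddBelow hz
  linarith [neg_abs_le (sInf (F x) - z)]

end ParameterDependence

/-! ### The space of admissible controls -/

section Controls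

open ProbabilityTheory

variable {m : ℕ} {U : Set (EuclideanSpace ℝ (Fin m))}

theorem ControlFunction.ext_ae {u v : ControlFunction U}
    (h : ∀ᵐ t : ℝ, u.toLp t = v.toLp t) : u = v := by
  cases u; cases v
  congr
  exact Lp.ext h

theorem ControlFunction.ae_norm_le {R : ℝ} (hR : ∀ x ∈ U, ‖x‖ ≤ R) (u : ControlFunction U) :
    ∀ᵐ t : ℝ, ‖u.toLp t‖ ≤ R :=
  u.ae_mem.mono fun _ ht => hR _ ht

theorem ControlFunction.integrable_inner (hU : IsCompact U) (u : ControlFunction U)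
    {g : ℝ → EuclideanSpace ℝ (Fin m)} (hg : Integrable g) :
    Integrable fun t => (inner ℝ (u.toLp t) (g t) : ℝ) := by
  obtain ⟨R, hR⟩ := hU.isBounded.exists_norm_le
  refine (hg.norm.const_mul R).mono' ((Lp.aestronglyMeasurable u.toLp).inner hg.1) ?_
  filter_upwards [u.ae_norm_le hR] with t ht
  exact (norm_inner_le_norm _ _).trans (by gcongr)

theorem ControlFunction.lipschitzWith_pairing {R : ℝ} (hU : IsCompact U) (hR0 : 0 ≤ R)
    (hR : ∀ x ∈ U, ‖x‖ ≤ R) (u : ControlFunction U) :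
    LipschitzWith R.toNNReal fun g : Lp (EuclideanSpace ℝ (Fin m)) 1 (volume : Measure ℝ) =>
      ∫ t : ℝ, (inner ℝ (u.toLp t) (g t) : ℝ) := by
  refine LipschitzWith.of_dist_le_mul fun g g' => ?_
  have hg := L1.integrable_coeFn g
  have hg' := L1.integrable_coeFn g'
  rw [Real.dist_eq, ← integral_sub (u.integrable_inner hU hg) (u.integrable_inner hU hg'),
    Real.coe_toNNReal _ hR0, dist_eq_norm, L1.norm_eq_integral_norm, ← integral_const_mul,
    ← Real.norm_eq_abs]
  refine norm_integral_le_of_norm_le ((L1.integrable_coeFn (g - g')).norm.const_mul R) ?_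
  filter_upwards [u.ae_norm_le hR, Lp.coeFn_sub g g'] with t ht h
  rw [← inner_sub_right, h]
  exact (norm_inner_le_norm _ _).trans (by gcongr; rfl)

/-- The topology of the controls is a variable here because the space carries an arbitrary metric
that induces the weak* topology. -/
theorem continuous_controlFunction_rng_iff [tU : TopologicalSpace (ControlFunction U)]
    (htU : tU = weakStarTopology U) {Z : Type*} [TopologicalSpace Z] {F : Z → ControlFunction U} :
    Continuous F ↔ ∀ g : Lp (EuclideanSpace ℝ (Fin m)) 1 (volume : Measure ℝ),
      Continuous fun z => ∫ t : ℝ, (inner ℝ ((F z).toLp t) (g t) : ℝ) := by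
  subst htU
  rw [continuous_induced_rng, continuous_pi_iff]
  rfl

theorem continuous_pairing [tU : TopologicalSpace (ControlFunction U)]
    (htU : tU = weakStarTopology U) (hU : IsCompact U) :
    Continuous fun q : Lp (EuclideanSpace ℝ (Fin m)) 1 (volume : Measure ℝ) × ControlFunction U =>
      ∫ t : ℝ, (inner ℝ (q.2.toLp t) (q.1 t) : ℝ) := by
  obtain ⟨R, hR0, hR⟩ := hU.isBounded.exists_pos_norm_le
  exact continuous_prod_of_continuous_lipschitzWith _ R.toNNReal
    (fun g => (continuous_controlFunction_rng_iff htU).1 continuous_id g)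
    fun u => u.lipschitzWith_pairing hU hR0.le hR

theorem shift_ae_eq (t : ℝ) (u : ControlFunction U) :
    ∀ᵐ s : ℝ, (shift t u).toLp s = u.toLp (t + s) :=
  Lp.coeFn_compMeasurePreserving u.toLp (measurePreserving_add_left (volume : Measure ℝ) t)

theorem shift_add (t s : ℝ) (u : ControlFunction U) : shift (t + s) u = shift s (shift t u) := by
  refine ControlFunction.ext_ae ?_
  have h := (measurePreserving_add_left (volume : Measure ℝ) s).quasiMeasurePreserving.ae
    (shift_ae_eq t u)
  filter_upwards [shift_ae_eq (t + s) u, shift_ae_eq s (shift t u), h] with r h1 h2 h3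
  rw [h1, h2, h3, add_assoc]

theorem continuous_shift [tU : TopologicalSpace (ControlFunction U)]
    (htU : tU = weakStarTopology U) (hU : IsCompact U) :
    Continuous fun q : ℝ × ControlFunction U => shift q.1 q.2 := by
  rw [continuous_controlFunction_rng_iff htU]
  intro g
  -- the shift is moved to `g`, and translations act continuously on `L¹`
  have hcurry : Continuous fun t : ℝ => (⟨fun s : ℝ => -t + s, by fun_prop⟩ : C(ℝ, ℝ)) :=
    ContinuousMap.continuous_of_continuous_uncurry _ (by
      change Continuous fun p : ℝ × ℝ => -p.1 + p.2
      fun_prop)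
  have htr : Continuous fun t : ℝ => Lp.compMeasurePreserving (fun s : ℝ => -t + s)
      (measurePreserving_add_left (volume : Measure ℝ) (-t)) g :=
    Continuous.compMeasurePreservingLp (continuous_const (y := g)) hcurry
      (fun t => measurePreserving_add_left (volume : Measure ℝ) (-t)) ENNReal.one_ne_top
  convert (continuous_pairing htU hU).comp
    ((htr.comp continuous_fst).prodMk (continuous_snd (X := ℝ) (Y := ControlFunction U)))
    using 2 with q
  obtain ⟨t, u⟩ := q
  simp only [Function.comp_apply]
  refine Eq.trans ?_ (integral_add_left_eq_self (fun s => (inner ℝ (u.toLp s)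
    (Lp.compMeasurePreserving (fun s : ℝ => -t + s)
      (measurePreserving_add_left (volume : Measure ℝ) (-t)) g s) : ℝ)) t)
  refine integral_congr_ae ?_
  have h1 := (measurePreserving_add_left (volume : Measure ℝ) t).quasiMeasurePreserving.ae
    (Lp.coeFn_compMeasurePreserving g (measurePreserving_add_left (volume : Measure ℝ) (-t)))
  filter_upwards [shift_ae_eq t u, h1] with s h2 h3
  rw [h2, h3]
  simp

/-- The control function with a given representative. -/
noncomputable def controlOfFunction (hU : IsCompact U) (h : ℝ → EuclideanSpace ℝ (Fin m))
    (hm : AEStronglyMeasurable h) (hmem : ∀ᵐ t : ℝ, h t ∈ U) : ControlFunction U :=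
  have hb : MemLp h ∞ :=
    memLp_top_of_bound hm hU.isBounded.exists_norm_le.choose
      (hmem.mono fun _ ht => hU.isBounded.exists_norm_le.choose_spec _ ht)
  { toLp := hb.toLp h
    ae_mem := by
      filter_upwards [hb.coeFn_toLp, hmem] with t h1 h2
      rwa [h1] }

theorem controlOfFunction_ae_eq (hU : IsCompact U) (h : ℝ → EuclideanSpace ℝ (Fin m))
    (hm : AEStronglyMeasurable h) (hmem : ∀ᵐ t : ℝ, h t ∈ U) :
    ∀ᵐ t : ℝ, (controlOfFunction hU h hm hmem).toLp t = h t := by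
  exact MemLp.coeFn_toLp (memLp_top_of_bound hm hU.isBounded.exists_norm_le.choose
      (hmem.mono fun _ ht => hU.isBounded.exists_norm_le.choose_spec _ ht))

/-- The square integrable functions for a Gaussian measure with values in `U`. As the measure is
finite and equivalent to Lebesgue measure, these are the admissible controls again, now in a
Hilbert space. -/
noncomputable def gaussianControls (U : Set (EuclideanSpace ℝ (Fin m))) :
    Set (Lp (EuclideanSpace ℝ (Fin m)) 2 (gaussianReal 0 1)) :=
  {h | ∀ᵐ t ∂(gaussianReal 0 1), h t ∈ U}

theorem convex_gaussianControls (hU : Convex ℝ U) : Convex ℝ (gaussianControls U) := by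
  intro x hx y hy a b ha hb hab
  change ∀ᵐ t ∂(gaussianReal 0 1), (a • x + b • y : Lp _ 2 _) t ∈ U
  filter_upwards [hx, hy, Lp.coeFn_add (a • x) (b • y), Lp.coeFn_smul a x, Lp.coeFn_smul b y]
    with t h1 h2 h3 h4 h5
  rw [h3, Pi.add_apply, h4, h5]
  exact hU h1 h2 ha hb hab

theorem isClosed_gaussianControls (hU : IsClosed U) : IsClosed (gaussianControls U) := by
  refine IsSeqClosed.isClosed fun x y hx hxy => ?_
  have h1 : TendstoInMeasure (gaussianReal 0 1) (fun k => (x k : ℝ → EuclideanSpace ℝ (Fin m)))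
      atTop y := tendstoInMeasure_of_tendsto_Lp hxy
  obtain ⟨ns, -, hns⟩ := h1.exists_seq_tendsto_ae
  have h2 : ∀ᵐ t ∂(gaussianReal 0 1), ∀ k, x k t ∈ U := ae_all_iff.2 hx
  change ∀ᵐ t ∂(gaussianReal 0 1), y t ∈ U
  filter_upwards [hns, h2] with t h3 h4
  exact hU.mem_of_tendsto h3 (Eventually.of_forall fun k => h4 _)

/-- A bounded closed convex subset of a real Hilbert space is weakly compact. -/
theorem isCompact_image_toDual_of_convex {H : Type*} [NormedAddCommGroup H] [InnerProductSpace ℝ H]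
    [CompleteSpace H] {K : Set H} (hK : Convex ℝ K) (hcl : IsClosed K)
    (hb : Bornology.IsBounded K) :
    IsCompact ((fun x => StrongDual.toWeakDual (InnerProductSpace.toDual ℝ H x)) '' K) := by
  obtain ⟨R, hR⟩ := hb.exists_norm_le
  refine (WeakDual.isCompact_closedBall (𝕜 := ℝ) (E := H) 0 R).of_isClosed_subset ?_ ?_
  · refine isOpen_compl_iff.1 (isOpen_iff_mem_nhds.2 fun l hl => ?_)
    set x := (InnerProductSpace.toDual ℝ H).symm (WeakDual.toStrongDual l) with hx
    have hlx : StrongDual.toWeakDual (InnerProductSpace.toDual ℝ H x) = l := by simp [hx]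
    have hxK : x ∉ K := fun h => hl ⟨x, h, hlx⟩
    obtain ⟨f, s, h1, h2⟩ := geometric_hahn_banach_closed_point hK hcl hxK
    set a := (InnerProductSpace.toDual ℝ H).symm f with ha
    have hfa : ∀ y, f y = inner ℝ y a := fun y => by
      rw [real_inner_comm, ha, InnerProductSpace.toDual_symm_apply]
    have hopen : IsOpen {l' : WeakDual ℝ H | s < l' a} :=
      isOpen_lt continuous_const (WeakDual.eval_continuous a)
    refine mem_of_superset (hopen.mem_nhds ?_) ?_
    · rw [← hlx]
      change s < inner ℝ x a
      rwa [← hfa]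
    · rintro _ h3 ⟨y, hy, rfl⟩
      have h4 := h1 y hy
      rw [hfa] at h4
      exact lt_asymm h4 h3
  · rintro _ ⟨x, hx, rfl⟩
    simpa using hR x hx

/-- Functions of the form `t ↦ w(t) a(t)`, where `w` is the Gaussian density and `a` is square
integrable for the Gaussian measure, are dense in `L¹`. -/
theorem dense_gaussianPDF_smul :
    Dense {g : Lp (EuclideanSpace ℝ (Fin m)) 1 (volume : Measure ℝ) |
      ∃ a : Lp (EuclideanSpace ℝ (Fin m)) 2 (gaussianReal 0 1),
        ∀ᵐ t : ℝ, g t = gaussianPDFReal 0 1 t • a t} := by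
  have hpdf : Continuous (gaussianPDFReal 0 1) := by
    unfold gaussianPDFReal
    fun_prop
  have hpos : ∀ t, gaussianPDFReal 0 1 t ≠ 0 := fun t => (gaussianPDFReal_pos 0 1 t one_ne_zero).ne'
  generalize gaussianPDFReal 0 1 = w at hpdf hpos ⊢
  rw [Metric.dense_iff]
  intro g r hr
  obtain ⟨g', hsupp, hg', hcont, hmem⟩ :=
    (Lp.memLp g).exists_hasCompactSupport_eLpNorm_sub_le ENNReal.one_ne_top
      (ε := ENNReal.ofReal (r / 2)) (by simpa using hr)
  have ha : MemLp (fun t => (w t)⁻¹ • g' t) 2 (gaussianReal 0 1) := by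
    refine Continuous.memLp_of_hasCompactSupport ?_
      (hsupp.mono fun t ht h0 => ht (by simp [h0]))
    exact (hpdf.inv₀ hpos).smul hcont
  refine ⟨hmem.toLp g', ?_, ha.toLp _, ?_⟩
  · rw [Metric.mem_ball, dist_comm, Lp.dist_def]
    have h1 : eLpNorm (g - hmem.toLp g' : ℝ → EuclideanSpace ℝ (Fin m)) 1 volume ≤
        ENNReal.ofReal (r / 2) := by
      refine le_trans (le_of_eq (eLpNorm_congr_ae ?_)) hg'
      filter_upwards [hmem.coeFn_toLp] with t ht
      simp [ht]
    exact (ENNReal.toReal_le_of_le_ofReal (by positivity) h1).trans_lt (by linarith)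
  · filter_upwards [hmem.coeFn_toLp,
      (gaussianReal_absolutelyContinuous' 0 one_ne_zero).ae_eq ha.coeFn_toLp] with t h1 h2
    rw [h1, h2, smul_smul, mul_inv_cancel₀ (hpos t), one_smul]

/-- The controls with the weak* topology are a continuous image of `gaussianControls U` with the weak
topology of `L²`: continuity of the pairing with `g ∈ L¹` holds for the dense set of those `g` which
are represented by an element of `L²`, and the pairings are uniformly Lipschitz in `g`. -/
theorem compactSpace_controlFunction [tU : TopologicalSpace (ControlFunction U)]
    (htU : tU = weakStarTopology U) (hU : IsCompact U) (hconv : Convex ℝ U) :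
    CompactSpace (ControlFunction U) := by
  obtain ⟨R, hR0, hR⟩ := hU.isBounded.exists_pos_norm_le
  have hac : (volume : Measure ℝ) ≪ gaussianReal 0 1 :=
    gaussianReal_absolutelyContinuous' 0 one_ne_zero
  have hac' : gaussianReal 0 1 ≪ (volume : Measure ℝ) :=
    gaussianReal_absolutelyContinuous 0 one_ne_zero
  set H := Lp (EuclideanSpace ℝ (Fin m)) 2 (gaussianReal 0 1) with hH
  have hbdd : Bornology.IsBounded (gaussianControls U) := by
    refine isBounded_iff_forall_norm_le.2 ⟨_, fun h hh => Lp.norm_le_of_ae_bound hR0.le ?_⟩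
    exact Eventually.mono (show ∀ᵐ t ∂(gaussianReal 0 1), h t ∈ U from hh) fun t ht => hR _ ht
  set J : H → WeakDual ℝ H := fun x => StrongDual.toWeakDual (InnerProductSpace.toDual ℝ H x)
    with hJ
  have hS : IsCompact (J '' gaussianControls U) :=
    isCompact_image_toDual_of_convex (convex_gaussianControls hconv)
      (isClosed_gaussianControls hU.isClosed) hbdd
  have hJinj : Function.Injective J := fun x y h => by simpa [hJ] using h
  let e : gaussianControls U ≃ J '' gaussianControls U := Equiv.Set.image J _ hJinj
  let C : gaussianControls U → ControlFunction U := fun h =>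
    controlOfFunction hU h.1 ((Lp.aestronglyMeasurable h.1).mono_ac hac) (hac.ae_le h.2)
  have hC : ∀ h : gaussianControls U, ∀ᵐ t : ℝ, (C h).toLp t = h.1 t := fun h =>
    controlOfFunction_ae_eq hU _ _ _
  have hcont : Continuous fun l => C (e.symm l) := by
    rw [continuous_controlFunction_rng_iff htU]
    intro g
    let P : Lp (EuclideanSpace ℝ (Fin m)) 1 (volume : Measure ℝ) → J '' gaussianControls U → ℝ :=
      fun g l => ∫ t : ℝ, (inner ℝ ((C (e.symm l)).toLp t) (g t) : ℝ)
    have hprod : Continuous (Function.uncurry P) := by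
      refine continuous_prod_of_dense_continuous_lipschitzWith _ R.toNNReal
        dense_gaussianPDF_smul ?_ fun l => (C (e.symm l)).lipschitzWith_pairing hU hR0.le hR
      rintro g ⟨a, ha⟩
      have h1 : Continuous fun l : J '' gaussianControls U => (l : WeakDual ℝ H) a :=
        (WeakDual.eval_continuous a).comp continuous_subtype_val
      refine h1.congr fun l => ?_
      obtain ⟨h, rfl⟩ := e.surjective l
      have h0 : ((e h : J '' gaussianControls U) : WeakDual ℝ H) a =
          ∫ t, (inner ℝ ((h : H) t) (a t) : ℝ) ∂(gaussianReal 0 1) := L2.inner_def (h : H) a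
      change _ = ∫ t : ℝ, (inner ℝ ((C (e.symm (e h))).toLp t) (g t) : ℝ)
      rw [e.symm_apply_apply, h0, integral_gaussianReal_eq_integral_smul one_ne_zero]
      refine integral_congr_ae ?_
      filter_upwards [ha, hC h] with t h2 h3
      rw [h2, h3, real_inner_smul_right, smul_eq_mul]
    exact hprod.uncurry_left g
  have hsurj : Function.Surjective fun l => C (e.symm l) := by
    intro u
    have hb : MemLp u.toLp 2 (gaussianReal 0 1) :=
      MemLp.of_bound ((Lp.aestronglyMeasurable u.toLp).mono_ac hac') R
        (hac'.ae_le (u.ae_norm_le hR))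
    have hmem : hb.toLp _ ∈ gaussianControls U := by
      change ∀ᵐ t ∂(gaussianReal 0 1), hb.toLp _ t ∈ U
      filter_upwards [hb.coeFn_toLp, hac'.ae_le u.ae_mem] with t h1 h2
      rw [h1]
      exact h2
    refine ⟨e ⟨_, hmem⟩, ControlFunction.ext_ae ?_⟩
    simp only [e.symm_apply_apply]
    filter_upwards [hC ⟨_, hmem⟩, hac.ae_eq hb.coeFn_toLp] with t h1 h2
    rw [h1, h2]
  have := isCompact_iff_compactSpace.1 hS
  refine ⟨?_⟩
  rw [← hsurj.range_eq]
  exact isCompact_range hcont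

end Controls

/-! ### Smooth maps compared with an embedding -/

section Embedding

variable {n : ℕ} {M : Type*} [TopologicalSpace M] [ChartedSpace (EuclideanSpace ℝ (Fin n)) M]
  {F F' : Type*} [NormedAddCommGroup F] [NormedSpace ℝ F] [NormedAddCommGroup F']
  [NormedSpace ℝ F']

theorem contDiffAt_comp_extChartAt_symm [IsManifold (𝓡 n) ∞ M] {g : M → F}
    (hg : ContMDiff (𝓡 n) 𝓘(ℝ, F) ∞ g) (x₀ : M) :
    ContDiffAt ℝ ∞ (g ∘ (extChartAt (𝓡 n) x₀).symm) (extChartAt (𝓡 n) x₀ x₀) := by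
  refine ContMDiffAt.contDiffAt ?_
  refine ContMDiffAt.comp _ hg.contMDiffAt ?_
  exact (contMDiffOn_extChartAt_symm x₀).contMDiffAt (extChartAt_target_mem_nhds x₀)

/-- Near the diagonal, an immersion dominates every other smooth map. -/
theorem isBigO_sub_of_injective_mfderiv [IsManifold (𝓡 n) ∞ M] {e : M → F} {g : M → F'}
    (he : ContMDiff (𝓡 n) 𝓘(ℝ, F) ∞ e) (hg : ContMDiff (𝓡 n) 𝓘(ℝ, F') ∞ g) {x₀ : M}
    (hinj : Function.Injective (mfderiv (𝓡 n) 𝓘(ℝ, F) e x₀)) :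
    (fun p : M × M => g p.1 - g p.2) =O[𝓝 (x₀, x₀)] fun p => e p.1 - e p.2 := by
  set ψ := extChartAt (𝓡 n) x₀ with hψ
  have h1 := (contDiffAt_comp_extChartAt_symm he x₀).hasStrictFDerivAt (by simp)
  have h2 := (contDiffAt_comp_extChartAt_symm hg x₀).hasStrictFDerivAt (by simp)
  have hD : Function.Injective (fderiv ℝ (e ∘ ψ.symm) (ψ x₀)) := by
    rw [(he.contMDiffAt.mdifferentiableAt (by simp)).mfderiv] at hinj
    have h : Function.Injective (fderivWithin ℝ (writtenInExtChartAt (𝓡 n) 𝓘(ℝ, F) x₀ e)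
      (range (𝓡 n)) (ψ x₀)) := hinj
    simpa [writtenInExtChartAt, hψ, chartAt_self_eq, Function.comp_def] using h
  obtain ⟨K, -, hK⟩ := LinearMap.exists_antilipschitzWith
    (fderiv ℝ (e ∘ ψ.symm) (ψ x₀) : EuclideanSpace ℝ (Fin n) →ₗ[ℝ] F) (LinearMap.ker_eq_bot.2 hD)
  have h4 : (fun q : EuclideanSpace ℝ (Fin n) × EuclideanSpace ℝ (Fin n) => q.1 - q.2)
      =O[𝓝 (ψ x₀, ψ x₀)] fun q => fderiv ℝ (e ∘ ψ.symm) (ψ x₀) (q.1 - q.2) :=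
    Asymptotics.IsBigO.of_bound K (Eventually.of_forall fun q => by
      simpa using hK.le_mul_dist (q.1 - q.2) 0)
  have h5 := (h1.isLittleO.trans_isBigO h4).right_isBigO_add
  have h3 := (h2.isBigO_sub).trans (h4.trans (h5.congr_right fun q => sub_add_cancel _ _))
  have ht : Tendsto (fun p : M × M => (ψ p.1, ψ p.2)) (𝓝 (x₀, x₀)) (𝓝 (ψ x₀, ψ x₀)) := by
    have hc := continuousAt_extChartAt (I := 𝓡 n) x₀
    exact (hc.comp (x := (x₀, x₀)) continuousAt_fst).prodMk_nhds
      (hc.comp (x := (x₀, x₀)) continuousAt_snd)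
  have hev : ∀ᶠ p : M × M in 𝓝 (x₀, x₀), ψ.symm (ψ p.1) = p.1 ∧ ψ.symm (ψ p.2) = p.2 := by
    have hs := extChartAt_source_mem_nhds (I := 𝓡 n) x₀
    rw [nhds_prod_eq]
    filter_upwards [prod_mem_prod hs hs] with p hp
    exact ⟨ψ.left_inv hp.1, ψ.left_inv hp.2⟩
  refine (h3.comp_tendsto ht).congr' ?_ ?_
  · filter_upwards [hev] with p hp
    change g (ψ.symm (ψ p.1)) - g (ψ.symm (ψ p.2)) = _
    rw [hp.1, hp.2]
  · filter_upwards [hev] with p hp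
    change e (ψ.symm (ψ p.1)) - e (ψ.symm (ψ p.2)) = _
    rw [hp.1, hp.2]

/-- On a compact manifold, every smooth map is Lipschitz with respect to the distance induced by an
embedding into a vector space. -/
theorem exists_norm_sub_le_of_embedding [IsManifold (𝓡 n) ∞ M] [CompactSpace M] {e : M → F}
    {g : M → F'} (he : ContMDiff (𝓡 n) 𝓘(ℝ, F) ∞ e) (hinj : Function.Injective e)
    (hinj' : ∀ x, Function.Injective (mfderiv (𝓡 n) 𝓘(ℝ, F) e x))
    (hg : ContMDiff (𝓡 n) 𝓘(ℝ, F') ∞ g) :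
    ∃ L : ℝ, 0 ≤ L ∧ ∀ x y, ‖g x - g y‖ ≤ L * ‖e x - e y‖ := by
  have hloc : ∀ p : M × M, ∃ L : ℝ, ∀ᶠ q in 𝓝 p, ‖g q.1 - g q.2‖ ≤ L * ‖e q.1 - e q.2‖ := by
    rintro ⟨x, y⟩
    rcases eq_or_ne x y with rfl | hxy
    · exact (isBigO_sub_of_injective_mfderiv he hg (hinj' x)).bound
    -- off the diagonal the right-hand side is bounded away from `0`
    · have hec : Continuous fun q : M × M => ‖e q.1 - e q.2‖ :=
        ((he.continuous.comp continuous_fst).sub (he.continuous.comp continuous_snd)).norm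
      have hgc : Continuous fun q : M × M => ‖g q.1 - g q.2‖ :=
        ((hg.continuous.comp continuous_fst).sub (hg.continuous.comp continuous_snd)).norm
      have hpos : 0 < ‖e x - e y‖ := norm_pos_iff.2 (sub_ne_zero.2 (hinj.ne hxy))
      have h1 := (hec.tendsto (x, y)).eventually_const_lt (half_lt_self hpos)
      have h2 := (hgc.tendsto (x, y)).eventually_lt_const (lt_add_one ‖g x - g y‖)
      refine ⟨(‖g x - g y‖ + 1) / (‖e x - e y‖ / 2), ?_⟩
      filter_upwards [h1, h2] with q h3 h4
      rw [div_mul_eq_mul_div, le_div_iff₀ (by positivity)]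
      gcongr
  choose L hL using hloc
  obtain ⟨s, hs⟩ := CompactSpace.elim_nhds_subcover _ hL
  refine ⟨∑ p ∈ s, |L p|, Finset.sum_nonneg fun _ _ => abs_nonneg _, fun x y => ?_⟩
  have hmem : (x, y) ∈ ⋃ p ∈ s, {q : M × M | ‖g q.1 - g q.2‖ ≤ L p * ‖e q.1 - e q.2‖} := by
    rw [hs]; trivial
  simp only [mem_iUnion] at hmem
  obtain ⟨p, hp, h⟩ := hmem
  refine (show ‖g x - g y‖ ≤ L p * ‖e x - e y‖ from h).trans ?_
  gcongr
  exact (le_abs_self _).trans (Finset.single_le_sum (f := fun p => |L p|)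
    (fun _ _ => abs_nonneg _) hp)

/-- The vector field `v` read through `e`: the function `x ↦ de_x(v(x))`. -/
noncomputable def pushField (e : M → F) (v : (x : M) → TangentSpace (𝓡 n) x) (x : M) : F :=
  mfderiv (𝓡 n) 𝓘(ℝ, F) e x (v x)

theorem contMDiff_pushField [IsManifold (𝓡 n) ∞ M] {e : M → F}
    (he : ContMDiff (𝓡 n) 𝓘(ℝ, F) ∞ e) {v : (x : M) → TangentSpace (𝓡 n) x}
    (hv : ContMDiff (𝓡 n) (𝓡 n).tangent ∞ fun x => (⟨x, v x⟩ : TangentBundle (𝓡 n) M)) :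
    ContMDiff (𝓡 n) 𝓘(ℝ, F) ∞ (pushField e v) :=
  (contMDiff_snd_tangentBundle_modelSpace F 𝓘(ℝ, F)).comp
    ((he.contMDiff_tangentMap (m := ∞) (by simp)).comp hv)

theorem continuous_pushField [IsManifold (𝓡 n) ∞ M] {Z : Type*} [TopologicalSpace Z] {e : M → F}
    (he : ContMDiff (𝓡 n) 𝓘(ℝ, F) ∞ e) {v : Z → (x : M) → TangentSpace (𝓡 n) x}
    (hv : Continuous fun p : Z × M => (⟨p.2, v p.1 p.2⟩ : TangentBundle (𝓡 n) M)) :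
    Continuous fun p : Z × M => pushField e (v p.1) p.2 :=
  (contMDiff_snd_tangentBundle_modelSpace F 𝓘(ℝ, F) (n := 0)).continuous.comp
    ((he.continuous_tangentMap (by simp)).comp hv)

end Embedding

/-! ### Gronwall's inequality in integral form -/

section Gronwall

theorem le_mul_exp_of_le_add_integral_of_nonneg {w : ℝ → ℝ} (hw : Continuous w)
    (hw0 : ∀ t, 0 ≤ w t) {δ K T : ℝ}
    (h : ∀ t ∈ Icc 0 T, w t ≤ δ + K * ∫ s in (0 : ℝ)..t, w s) (hK : 0 ≤ K) :
    ∀ t ∈ Icc 0 T, w t ≤ δ * Real.exp (K * t) := by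
  intro t ht
  have hd : ∀ s, HasDerivAt (fun t => ∫ s in (0 : ℝ)..t, w s) (w s) s := fun s =>
    hw.integral_hasStrictDerivAt 0 s |>.hasDerivAt
  have hpos : ∀ s ∈ Icc 0 T, 0 ≤ ∫ r in (0 : ℝ)..s, w r := fun s hs =>
    intervalIntegral.integral_nonneg hs.1 fun r _ => hw0 r
  have h1 := norm_le_gronwallBound_of_norm_deriv_right_le (f := fun t => ∫ s in (0 : ℝ)..t, w s)
    (f' := w) (δ := 0) (K := K) (ε := δ) (a := 0) (b := T)
    (fun s _ => (hd s).continuousAt.continuousWithinAt) (fun s _ => (hd s).hasDerivWithinAt)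
    (by simp) (fun s hs => by
      have hs' : s ∈ Icc 0 T := ⟨hs.1, hs.2.le⟩
      rw [Real.norm_of_nonneg (hw0 s), Real.norm_of_nonneg (hpos s hs')]
      linarith [h s hs']) t ht
  rw [Real.norm_of_nonneg (hpos t ht), sub_zero] at h1
  refine (h t ht).trans ?_
  rcases hK.eq_or_lt with rfl | hK
  · simp
  · rw [gronwallBound_of_K_ne_0 hK.ne'] at h1
    have h2 := mul_le_mul_of_nonneg_left h1 hK.le
    have h3 : K * (0 * Real.exp (K * t) + δ / K * (Real.exp (K * t) - 1)) =
        δ * Real.exp (K * t) - δ := by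
      field_simp
      ring
    linarith

theorem le_mul_exp_of_le_add_abs_integral {w : ℝ → ℝ} (hw : Continuous w)
    (hw0 : ∀ t, 0 ≤ w t) {δ K T : ℝ} (hK : 0 ≤ K)
    (h : ∀ t ∈ Icc (-T) T, w t ≤ δ + K * |∫ s in (0 : ℝ)..t, w s|) :
    ∀ t ∈ Icc (-T) T, w t ≤ δ * Real.exp (K * |t|) := by
  intro t ht
  rcases le_total 0 t with h0 | h0
  · rw [abs_of_nonneg h0]
    refine le_mul_exp_of_le_add_integral_of_nonneg hw hw0 (fun s hs => ?_) hK t ⟨h0, ht.2⟩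
    have h1 := h s ⟨by linarith [hs.1, hs.2], hs.2⟩
    rwa [abs_of_nonneg (intervalIntegral.integral_nonneg hs.1 fun r _ => hw0 r)] at h1
  · rw [abs_of_nonpos h0]
    have h2 := le_mul_exp_of_le_add_integral_of_nonneg (w := fun s => w (-s)) (hw.comp continuous_neg)
      (fun s => hw0 _) (δ := δ) (K := K) (T := T) (fun s hs => ?_) hK (-t)
      ⟨by linarith, by linarith [ht.1]⟩
    · simpa using h2
    · have h1 := h (-s) ⟨by linarith [hs.2], by linarith [hs.1, hs.2]⟩
      have h3 : (∫ r in (0 : ℝ)..s, w (-r)) = -∫ r in (0 : ℝ)..(-s), w r := by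
        rw [intervalIntegral.integral_comp_neg, neg_zero, intervalIntegral.integral_symm]
      have h4 : 0 ≤ ∫ r in (0 : ℝ)..s, w (-r) :=
        intervalIntegral.integral_nonneg hs.1 fun r _ => hw0 _
      rw [h3] at h4
      rw [abs_of_nonpos (by linarith)] at h1
      rwa [h3]

end Gronwall

/-! ### Solutions as curves satisfying an integral equation -/

section IntegralEquation

variable {m N : ℕ} {U : Set (EuclideanSpace ℝ (Fin m))} {M : Type*} [TopologicalSpace M]

/-- The right-hand side `g₀(x) + ∑ v_i g_i(x)` of a control-affine equation, as a function of the
control value `v` and the state `x`. -/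
def affineField (g₀ : M → EuclideanSpace ℝ (Fin N)) (g : Fin m → M → EuclideanSpace ℝ (Fin N))
    (v : EuclideanSpace ℝ (Fin m)) (x : M) : EuclideanSpace ℝ (Fin N) :=
  g₀ x + ∑ i, v i • g i x

/-- `c` is continuous and its image under `e` satisfies the integral equation with right-hand side
`V(u(t), c(t))`. -/
structure IsIntegralSolution (e : M → EuclideanSpace ℝ (Fin N))
    (V : EuclideanSpace ℝ (Fin m) → M → EuclideanSpace ℝ (Fin N)) (u : ControlFunction U)
    (c : ℝ → M) : Prop where
  continuous : Continuous c
  integral_eq : ∀ a b : ℝ, e (c b) - e (c a) = ∫ t in a..b, V (u.toLp t) (c t)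

theorem aestronglyMeasurable_field {V : EuclideanSpace ℝ (Fin m) → M → EuclideanSpace ℝ (Fin N)}
    (hV : Continuous fun q : EuclideanSpace ℝ (Fin m) × M => V q.1 q.2) (u : ControlFunction U)
    {c : ℝ → M} (hc : Continuous c) : AEStronglyMeasurable fun t : ℝ => V (u.toLp t) (c t) := by
  obtain ⟨u', hu', huu'⟩ := Lp.aestronglyMeasurable u.toLp
  have h1 : AEStronglyMeasurable (fun t : ℝ => V (u' t) (c t)) := by
    have h2 : Continuous fun q : EuclideanSpace ℝ (Fin m) × ℝ => V q.1 (c q.2) :=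
      hV.comp (continuous_fst.prodMk (hc.comp continuous_snd))
    exact h2.comp_aestronglyMeasurable
      (hu'.aestronglyMeasurable.prodMk continuous_id.aestronglyMeasurable)
  refine h1.congr ?_
  filter_upwards [huu'] with t ht
  rw [ht]

theorem intervalIntegrable_field [CompactSpace M] (hU : IsCompact U)
    {V : EuclideanSpace ℝ (Fin m) → M → EuclideanSpace ℝ (Fin N)}
    (hV : Continuous fun q : EuclideanSpace ℝ (Fin m) × M => V q.1 q.2) (u : ControlFunction U)
    {c : ℝ → M} (hc : Continuous c) (a b : ℝ) :
    IntervalIntegrable (fun t : ℝ => V (u.toLp t) (c t)) volume a b := by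
  obtain ⟨C, hC⟩ := (hU.prod isCompact_univ).exists_bound_of_continuousOn hV.continuousOn
  refine (intervalIntegrable_const (c := C)).mono_fun'
    (aestronglyMeasurable_field hV u hc).restrict ?_
  filter_upwards [ae_restrict_of_ae u.ae_mem] with t ht
  exact hC (u.toLp t, c t) ⟨ht, trivial⟩

theorem IsIntegralSolution.shift {e : M → EuclideanSpace ℝ (Fin N)}
    {V : EuclideanSpace ℝ (Fin m) → M → EuclideanSpace ℝ (Fin N)} {u : ControlFunction U}
    {c : ℝ → M} (hc : IsIntegralSolution e V u c) (t : ℝ) :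
    IsIntegralSolution e V (shift t u) fun s => c (t + s) := by
  refine ⟨hc.continuous.comp (by fun_prop), fun a b => ?_⟩
  rw [hc.integral_eq,
    ← intervalIntegral.integral_comp_add_left (fun s => V (u.toLp s) (c s)) t]
  refine intervalIntegral.integral_congr_ae ?_
  filter_upwards [shift_ae_eq t u] with s hs _
  rw [hs]

/-- Continuous dependence: two solutions of different equations with different controls stay close
if the initial values, the right-hand sides, and the integrals of the right-hand side along one
of the two curves for the two controls are close. -/
theorem IsIntegralSolution.norm_sub_le [CompactSpace M] (hU : IsCompact U)
    {e : M → EuclideanSpace ℝ (Fin N)} (he : Continuous e)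
    {V V₀ : EuclideanSpace ℝ (Fin m) → M → EuclideanSpace ℝ (Fin N)}
    (hV : Continuous fun q : EuclideanSpace ℝ (Fin m) × M => V q.1 q.2)
    (hV₀ : Continuous fun q : EuclideanSpace ℝ (Fin m) × M => V₀ q.1 q.2)
    {u u₀ : ControlFunction U} {c c₀ : ℝ → M} (hc : IsIntegralSolution e V u c)
    (hc₀ : IsIntegralSolution e V₀ u₀ c₀) {L η₁ η₂ η₃ T : ℝ} (hL0 : 0 ≤ L) (hη₂ : 0 ≤ η₂)
    (hL : ∀ v ∈ U, ∀ x y, ‖V₀ v x - V₀ v y‖ ≤ L * ‖e x - e y‖)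
    (h1 : ‖e (c 0) - e (c₀ 0)‖ ≤ η₁) (h2 : ∀ v ∈ U, ∀ x, ‖V v x - V₀ v x‖ ≤ η₂)
    (h3 : ∀ t ∈ Icc (-T) T, ‖(∫ s in (0 : ℝ)..t, V₀ (u.toLp s) (c₀ s)) -
      ∫ s in (0 : ℝ)..t, V₀ (u₀.toLp s) (c₀ s)‖ ≤ η₃) :
    ∀ t ∈ Icc (-T) T, ‖e (c t) - e (c₀ t)‖ ≤ (η₁ + T * η₂ + η₃) * Real.exp (L * |t|) := by
  have hw : Continuous fun t => ‖e (c t) - e (c₀ t)‖ :=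
    ((he.comp hc.continuous).sub (he.comp hc₀.continuous)).norm
  refine le_mul_exp_of_le_add_abs_integral hw (fun t => norm_nonneg _) hL0 fun t ht => ?_
  have i1 := intervalIntegrable_field hU hV u hc.continuous 0 t
  have i2 := intervalIntegrable_field hU hV₀ u hc.continuous 0 t
  have i3 := intervalIntegrable_field hU hV₀ u hc₀.continuous 0 t
  have habs : |t| ≤ T := abs_le.2 ⟨ht.1, ht.2⟩
  have hsplit : e (c t) - e (c₀ t) = (e (c 0) - e (c₀ 0)) +
      (∫ s in (0 : ℝ)..t, (V (u.toLp s) (c s) - V₀ (u.toLp s) (c s))) +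
      (∫ s in (0 : ℝ)..t, (V₀ (u.toLp s) (c s) - V₀ (u.toLp s) (c₀ s))) +
      ((∫ s in (0 : ℝ)..t, V₀ (u.toLp s) (c₀ s)) -
        ∫ s in (0 : ℝ)..t, V₀ (u₀.toLp s) (c₀ s)) := by
    rw [intervalIntegral.integral_sub i1 i2, intervalIntegral.integral_sub i2 i3,
      ← hc.integral_eq 0 t, ← hc₀.integral_eq 0 t]
    abel
  have b2 : ‖∫ s in (0 : ℝ)..t, (V (u.toLp s) (c s) - V₀ (u.toLp s) (c s))‖ ≤ T * η₂ := by
    have h := intervalIntegral.norm_integral_le_of_norm_le_const_ae (a := (0 : ℝ)) (b := t)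
      (f := fun s => V (u.toLp s) (c s) - V₀ (u.toLp s) (c s)) (C := η₂) (by
        filter_upwards [u.ae_mem] with s hs _
        exact h2 _ hs _)
    rw [sub_zero] at h
    nlinarith
  have b3 : ‖∫ s in (0 : ℝ)..t, (V₀ (u.toLp s) (c s) - V₀ (u.toLp s) (c₀ s))‖ ≤
      L * |∫ s in (0 : ℝ)..t, ‖e (c s) - e (c₀ s)‖| := by
    have h := intervalIntegral.norm_integral_le_abs_of_norm_le (μ := volume) (a := (0 : ℝ)) (b := t)
      (f := fun s => V₀ (u.toLp s) (c s) - V₀ (u.toLp s) (c₀ s))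
      (g := fun s => L * ‖e (c s) - e (c₀ s)‖) (by
        filter_upwards [ae_restrict_of_ae u.ae_mem] with s hs
        exact hL _ hs _ _) ((hw.const_mul L).intervalIntegrable _ _)
    rwa [intervalIntegral.integral_const_mul, abs_mul, abs_of_nonneg hL0] at h
  rw [hsplit]
  refine (norm_add_le _ _).trans ?_
  refine (add_le_add (norm_add₃_le) (h3 t ht)).trans ?_
  linarith

theorem IsIntegralSolution.eq_of_eq_zero [CompactSpace M] (hU : IsCompact U)
    {e : M → EuclideanSpace ℝ (Fin N)} (he : Continuous e) (hinj : Function.Injective e)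
    {V : EuclideanSpace ℝ (Fin m) → M → EuclideanSpace ℝ (Fin N)}
    (hV : Continuous fun q : EuclideanSpace ℝ (Fin m) × M => V q.1 q.2) {L : ℝ} (hL0 : 0 ≤ L)
    (hL : ∀ v ∈ U, ∀ x y, ‖V v x - V v y‖ ≤ L * ‖e x - e y‖) {u : ControlFunction U}
    {c c' : ℝ → M} (hc : IsIntegralSolution e V u c) (hc' : IsIntegralSolution e V u c')
    (h0 : c 0 = c' 0) : c = c' := by
  funext t
  have h := hc.norm_sub_le hU he hV hV hc' (η₁ := 0) (η₂ := 0) (η₃ := 0) (T := |t|) hL0 le_rfl hL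
    (by simp [h0]) (by simp) (by simp) t ⟨neg_abs_le t, le_abs_self t⟩
  refine hinj (sub_eq_zero.1 (norm_le_zero_iff.1 ?_))
  simpa using h

/-- The integrals of a control-affine right-hand side along a fixed curve are jointly continuous
in the control, for the weak* topology, and the upper limit. -/
theorem continuous_integral_affineField [CompactSpace M]
    [tU : TopologicalSpace (ControlFunction U)]
    (htU : tU = weakStarTopology U) (hU : IsCompact U) {g₀ : M → EuclideanSpace ℝ (Fin N)}
    {g : Fin m → M → EuclideanSpace ℝ (Fin N)} (hg₀ : Continuous g₀) (hg : ∀ i, Continuous (g i))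
    {c : ℝ → M} (hc : Continuous c) :
    Continuous fun q : ℝ × ControlFunction U =>
      ∫ s in (0 : ℝ)..q.1, affineField g₀ g (q.2.toLp s) (c s) := by
  have hV : Continuous fun q : EuclideanSpace ℝ (Fin m) × M => affineField g₀ g q.1 q.2 := by
    unfold affineField
    fun_prop
  obtain ⟨C, hC0, hC⟩ : ∃ C : ℝ, 0 ≤ C ∧ ∀ v ∈ U, ∀ x, ‖affineField g₀ g v x‖ ≤ C := by
    obtain ⟨C, hC⟩ := (hU.prod isCompact_univ).exists_bound_of_continuousOn hV.continuousOn
    exact ⟨max C 0, le_max_right _ _, fun v hv x => (hC (v, x) ⟨hv, trivial⟩).trans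
      (le_max_left _ _)⟩
  refine continuous_prod_of_continuous_lipschitzWith _ C.toNNReal (fun t => ?_) fun u => ?_
  · rw [← (EuclideanSpace.equiv (Fin N) ℝ).toHomeomorph.comp_continuous_iff, continuous_pi_iff]
    intro j
    -- each coordinate is a constant plus the pairing of the control with an integrable function
    let G : ℝ → EuclideanSpace ℝ (Fin m) := fun s => WithLp.toLp 2 fun i => g i (c s) j
    have hG : Continuous G := by fun_prop
    have hGi : Integrable ((uIoc 0 t).indicator G) :=
      (integrable_indicator_iff measurableSet_uIoc).2 hG.integrableOn_uIoc
    have h1 := (continuous_controlFunction_rng_iff htU).1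
      (continuous_id (X := ControlFunction U)) hGi.toL1
    refine ((h1.const_smul (if (0 : ℝ) ≤ t then (1 : ℝ) else -1)).const_add
      (∫ s in (0 : ℝ)..t, g₀ (c s) j)).congr fun u => ?_
    have hcoord : ∀ s, affineField g₀ g (u.toLp s) (c s) j =
        g₀ (c s) j + inner ℝ (u.toLp s) (G s) := fun s => by
      simp [affineField, G, PiLp.inner_apply, mul_comm]
    have hint : (∫ s in (0 : ℝ)..t, affineField g₀ g (u.toLp s) (c s)) j =
        ∫ s in (0 : ℝ)..t, affineField g₀ g (u.toLp s) (c s) j :=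
      ((EuclideanSpace.proj (𝕜 := ℝ) j).intervalIntegral_comp_comm
        (intervalIntegrable_field hU hV u hc 0 t)).symm
    change _ = (∫ s in (0 : ℝ)..t, affineField g₀ g (u.toLp s) (c s)) j
    have hi : IntervalIntegrable (fun s => g₀ (c s) j) volume 0 t :=
      Continuous.intervalIntegrable (by fun_prop) _ _
    have hpair : ∀ s, (inner ℝ (u.toLp s) ((uIoc 0 t).indicator G s) : ℝ) =
        (uIoc 0 t).indicator (fun s => (inner ℝ (u.toLp s) (G s) : ℝ)) s := fun s => by
      by_cases hs : s ∈ uIoc 0 t <;> simp [hs]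
    have hi' : IntervalIntegrable (fun s => (inner ℝ (u.toLp s) (G s) : ℝ)) volume 0 t := by
      rw [intervalIntegrable_iff, ← integrable_indicator_iff measurableSet_uIoc]
      exact (u.integrable_inner hU hGi).congr (Eventually.of_forall hpair)
    rw [hint]
    simp_rw [hcoord]
    rw [intervalIntegral.integral_add hi hi', intervalIntegral.intervalIntegral_eq_integral_uIoc
      (fun s => (inner ℝ (u.toLp s) (G s) : ℝ)), ← integral_indicator measurableSet_uIoc]
    refine congrArg₂ (· + ·) rfl (congrArg (fun r : ℝ => (if (0 : ℝ) ≤ t then (1 : ℝ) else -1) • r)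
      (integral_congr_ae ?_))
    filter_upwards [hGi.coeFn_toL1] with s hs
    rw [← hpair, hs]
    rfl
  · refine LipschitzWith.of_dist_le_mul fun t s => ?_
    rw [dist_eq_norm, intervalIntegral.integral_interval_sub_left
      (intervalIntegrable_field hU hV u hc 0 t) (intervalIntegrable_field hU hV u hc 0 s),
      Real.coe_toNNReal _ hC0, Real.dist_eq]
    refine intervalIntegral.norm_integral_le_of_norm_le_const_ae ?_
    filter_upwards [u.ae_mem] with r hr _
    exact hC _ hr _

/-- Solutions depend continuously on time, parameter, control and initial value, where the controls
carry the weak* topology. -/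
theorem continuous_of_isIntegralSolution [CompactSpace M]
    [tU : TopologicalSpace (ControlFunction U)]
    (htU : tU = weakStarTopology U) (hU : IsCompact U) {A : Type*} [TopologicalSpace A]
    {e : M → EuclideanSpace ℝ (Fin N)} (he : Topology.IsEmbedding e)
    {g₀ : A → M → EuclideanSpace ℝ (Fin N)} {g : Fin m → A → M → EuclideanSpace ℝ (Fin N)}
    (hg₀ : Continuous fun p : A × M => g₀ p.1 p.2)
    (hg : ∀ i, Continuous fun p : A × M => g i p.1 p.2)
    (hL : ∀ α, ∃ L, 0 ≤ L ∧ ∀ v ∈ U, ∀ x y, ‖affineField (g₀ α) (fun i => g i α) v x -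
      affineField (g₀ α) (fun i => g i α) v y‖ ≤ L * ‖e x - e y‖)
    {ψ : A → ℝ → M → ControlFunction U → M}
    (hψ : ∀ α x u, IsIntegralSolution e (affineField (g₀ α) fun i => g i α) u fun t => ψ α t x u)
    (hψ0 : ∀ α x u, ψ α 0 x u = x) :
    Continuous fun p : ℝ × A × (ControlFunction U × M) => ψ p.2.1 p.1 p.2.2.2 p.2.2.1 := by
  rw [he.isInducing.continuous_iff, continuous_iff_continuousAt]
  rintro ⟨t₀, α₀, u₀, x₀⟩
  have hV : Continuous fun q : A × (EuclideanSpace ℝ (Fin m) × M) =>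
      affineField (g₀ q.1) (fun i => g i q.1) q.2.1 q.2.2 := by
    have h1 : Continuous fun q : A × (EuclideanSpace ℝ (Fin m) × M) => g₀ q.1 q.2.2 :=
      hg₀.comp (continuous_fst.prodMk (continuous_snd.comp continuous_snd))
    have h2 : ∀ i, Continuous fun q : A × (EuclideanSpace ℝ (Fin m) × M) => g i q.1 q.2.2 :=
      fun i => (hg i).comp (continuous_fst.prodMk (continuous_snd.comp continuous_snd))
    unfold affineField
    fun_prop
  have hVα : ∀ α, Continuous fun q : EuclideanSpace ℝ (Fin m) × M =>
      affineField (g₀ α) (fun i => g i α) q.1 q.2 := fun α =>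
    hV.comp (continuous_const.prodMk continuous_id)
  obtain ⟨L, hL0, hL⟩ := hL α₀
  refine Metric.tendsto_nhds.2 fun ε hε => ?_
  set T := |t₀| + 1 with hT
  have hT0 : 0 ≤ T := by positivity
  set κ := ε / (2 * (T + 3) * Real.exp (L * T)) with hκ
  have hκ0 : 0 < κ := by positivity
  have hκε : (κ + T * κ + κ) * Real.exp (L * T) < ε / 2 := by
    have : (κ + T * κ + κ) * Real.exp (L * T) = ε / 2 * ((T + 2) / (T + 3)) := by
      rw [hκ]
      field_simp
      ring
    rw [this]
    exact mul_lt_of_lt_one_right (by positivity) ((div_lt_one (by positivity)).2 (by linarith))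
  -- the right-hand sides are close
  have evα : ∀ᶠ α in 𝓝 α₀, ∀ q ∈ U ×ˢ (univ : Set M),
      ‖affineField (g₀ α) (fun i => g i α) q.1 q.2 -
        affineField (g₀ α₀) (fun i => g i α₀) q.1 q.2‖ < κ := by
    refine (hU.prod isCompact_univ).eventually_forall_of_forall_eventually fun q _ => ?_
    have hc := (hV.sub ((hVα α₀).comp continuous_snd)).norm
    exact (hc.tendsto (α₀, q)).eventually_lt_const (by simpa using hκ0)
  -- the integrals along the reference solution are close
  have evu : ∀ᶠ u in 𝓝 u₀, ∀ t ∈ Icc (-T) T,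
      ‖(∫ s in (0 : ℝ)..t, affineField (g₀ α₀) (fun i => g i α₀) (u.toLp s) (ψ α₀ s x₀ u₀)) -
        ∫ s in (0 : ℝ)..t, affineField (g₀ α₀) (fun i => g i α₀) (u₀.toLp s) (ψ α₀ s x₀ u₀)‖
        < κ := by
    refine isCompact_Icc.eventually_forall_of_forall_eventually fun t _ => ?_
    have hJ := continuous_integral_affineField htU hU (hg₀.comp (Continuous.prodMk_right α₀))
      (fun i => (hg i).comp (Continuous.prodMk_right α₀)) (hψ α₀ x₀ u₀).continuous
    have hc := ((hJ.comp continuous_swap).sub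
      (hJ.comp ((continuous_snd (X := ControlFunction U)).prodMk (continuous_const (y := u₀))))).norm
    exact (hc.tendsto (u₀, t)).eventually_lt_const (by simpa using hκ0)
  have evx : ∀ᶠ x in 𝓝 x₀, ‖e x - e x₀‖ < κ :=
    ((he.continuous.sub continuous_const).norm.tendsto x₀).eventually_lt_const (by simpa using hκ0)
  have evt : ∀ᶠ t in 𝓝 t₀, dist (e (ψ α₀ t x₀ u₀)) (e (ψ α₀ t₀ x₀ u₀)) < ε / 2 :=
    Metric.tendsto_nhds.1 ((he.continuous.comp (hψ α₀ x₀ u₀).continuous).tendsto t₀) _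
      (half_pos hε)
  have evt' : ∀ᶠ t in 𝓝 t₀, |t| < T :=
    (continuous_abs.tendsto t₀).eventually_lt_const (lt_add_one _)
  rw [nhds_prod_eq, nhds_prod_eq, nhds_prod_eq]
  filter_upwards [prod_mem_prod (inter_mem evt evt')
    (prod_mem_prod evα (prod_mem_prod evu evx))] with ⟨t, α, u, x⟩ ⟨⟨k1, k2⟩, k3, k4, k5⟩
  have hmain := (hψ α x u).norm_sub_le hU he.continuous (hVα α) (hVα α₀) (hψ α₀ x₀ u₀)
    (η₁ := κ) (η₂ := κ) (η₃ := κ) (T := T) hL0 hκ0.le hL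
    (by simpa [hψ0] using (show ‖e x - e x₀‖ < κ from k5).le)
    (fun v hv y => (k3 (v, y) ⟨hv, trivial⟩).le) (fun s hs => (k4 s hs).le) t
    (abs_le.1 (show |t| < T from k2).le)
  have hexp : Real.exp (L * |t|) ≤ Real.exp (L * T) :=
    Real.exp_le_exp.2 (mul_le_mul_of_nonneg_left (show |t| < T from k2).le hL0)
  have hfin : ‖e (ψ α t x u) - e (ψ α₀ t x₀ u₀)‖ < ε / 2 :=
    (hmain.trans (mul_le_mul_of_nonneg_left hexp (by positivity))).trans_lt hκε
  rw [← dist_eq_norm] at hfin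
  have k1' : dist (e (ψ α₀ t x₀ u₀)) (e (ψ α₀ t₀ x₀ u₀)) < ε / 2 := k1
  have h4 := dist_triangle (e (ψ α t x u)) (e (ψ α₀ t x₀ u₀)) (e (ψ α₀ t₀ x₀ u₀))
  simp only [Function.comp_apply]
  linarith

/-- A Carathéodory solution satisfies the integral equation read through a smooth map `e`: the
coordinates of `e ∘ c` are absolutely continuous, hence integrals of their derivatives. -/
theorem IsSolution.isIntegralSolution {n : ℕ} [ChartedSpace (EuclideanSpace ℝ (Fin n)) M]
    [CompactSpace M] (hU : IsCompact U) {e : M → EuclideanSpace ℝ (Fin N)}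
    (he : ContMDiff (𝓡 n) 𝓘(ℝ, EuclideanSpace ℝ (Fin N)) ∞ e)
    {f₀ : (x : M) → TangentSpace (𝓡 n) x} {f : Fin m → (x : M) → TangentSpace (𝓡 n) x}
    (hf₀ : Continuous (pushField e f₀)) (hf : ∀ i, Continuous (pushField e (f i)))
    {u : ControlFunction U} {c : ℝ → M} (hc : IsSolution f₀ f u c) :
    IsIntegralSolution e (affineField (pushField e f₀) fun i => pushField e (f i)) u c := by
  have hV : Continuous fun q : EuclideanSpace ℝ (Fin m) × M =>
      affineField (pushField e f₀) (fun i => pushField e (f i)) q.1 q.2 := by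
    unfold affineField
    fun_prop
  refine ⟨hc.continuous, fun a b => ?_⟩
  have hderiv : ∀ᵐ t : ℝ, HasDerivAt (fun t => e (c t))
      (affineField (pushField e f₀) (fun i => pushField e (f i)) (u.toLp t) (c t)) t := by
    filter_upwards [hc.hasMFDerivAt] with t ht
    have h1 := ((he.contMDiffAt (x := c t)).mdifferentiableAt (by simp)).hasMFDerivAt.comp t ht
    let D : TangentSpace (𝓡 n) (c t) →L[ℝ] EuclideanSpace ℝ (Fin N) :=
      mfderiv (𝓡 n) 𝓘(ℝ, EuclideanSpace ℝ (Fin N)) e (c t)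
    let v : TangentSpace (𝓡 n) (c t) := f₀ (c t) + ∑ i, u.toLp t i • f i (c t)
    let D' : ℝ →L[ℝ] EuclideanSpace ℝ (Fin N) := D.comp ((1 : ℝ →L[ℝ] ℝ).smulRight v)
    have h2 : HasFDerivAt (e ∘ c) D' t := h1.hasFDerivAt
    have h3 : D' 1 = affineField (pushField e f₀) (fun i => pushField e (f i)) (u.toLp t) (c t) := by
      change D ((1 : ℝ) • v) = D (f₀ (c t)) + ∑ i, u.toLp t i • D (f i (c t))
      simp [v]
    rw [← h3]
    exact h2.hasDerivAt
  ext j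
  have hproj : ContMDiff (𝓡 n) 𝓘(ℝ, ℝ) ∞ fun x => e x j :=
    (EuclideanSpace.proj (𝕜 := ℝ) j).contMDiff.comp he
  have hac := hc.absolutelyContinuous _ hproj a b
  have hint : (∫ t in a..b, affineField (pushField e f₀) (fun i => pushField e (f i))
      (u.toLp t) (c t)) j = ∫ t in a..b, affineField (pushField e f₀)
        (fun i => pushField e (f i)) (u.toLp t) (c t) j :=
    ((EuclideanSpace.proj (𝕜 := ℝ) j).intervalIntegral_comp_comm
      (intervalIntegrable_field hU hV u hc.continuous a b)).symm
  rw [hint, PiLp.sub_apply, ← hac.integral_deriv_eq_sub]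
  refine intervalIntegral.integral_congr_ae ?_
  filter_upwards [hderiv] with t ht _
  exact ((EuclideanSpace.proj (𝕜 := ℝ) j).hasFDerivAt.comp_hasDerivAt t ht).deriv

end IntegralEquation

/-! ### Transition maps of complete control-affine systems -/

section TransitionMap

variable {n m N : ℕ} {U : Set (EuclideanSpace ℝ (Fin m))} {M : Type*} [TopologicalSpace M]
  [ChartedSpace (EuclideanSpace ℝ (Fin n)) M]

theorem isSolution_transitionMap {f₀ : (x : M) → TangentSpace (𝓡 n) x}
    {f : Fin m → (x : M) → TangentSpace (𝓡 n) x} (hcomplete : IsCompleteSystem U f₀ f) (x : M)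
    (u : ControlFunction U) :
    IsSolution f₀ f u (fun t => transitionMap f₀ f t x u) ∧ transitionMap f₀ f 0 x u = x := by
  have h := hcomplete x u
  have heq : ∀ t, transitionMap f₀ f t x u = h.choose t := fun t => dif_pos h
  simp only [heq]
  exact h.choose_spec

theorem exists_lipschitz_affineField [IsManifold (𝓡 n) ∞ M] [CompactSpace M] (hU : IsCompact U)
    {e : M → EuclideanSpace ℝ (Fin N)} (he : ContMDiff (𝓡 n) 𝓘(ℝ, EuclideanSpace ℝ (Fin N)) ∞ e)
    (hinj : Function.Injective e)
    (hinj' : ∀ x, Function.Injective (mfderiv (𝓡 n) 𝓘(ℝ, EuclideanSpace ℝ (Fin N)) e x))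
    {g₀ : M → EuclideanSpace ℝ (Fin N)} {g : Fin m → M → EuclideanSpace ℝ (Fin N)}
    (hg₀ : ContMDiff (𝓡 n) 𝓘(ℝ, EuclideanSpace ℝ (Fin N)) ∞ g₀)
    (hg : ∀ i, ContMDiff (𝓡 n) 𝓘(ℝ, EuclideanSpace ℝ (Fin N)) ∞ (g i)) :
    ∃ L, 0 ≤ L ∧ ∀ v ∈ U, ∀ x y,
      ‖affineField g₀ g v x - affineField g₀ g v y‖ ≤ L * ‖e x - e y‖ := by
  obtain ⟨R, hR0, hR⟩ := hU.isBounded.exists_pos_norm_le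
  obtain ⟨L₀, hL₀, h₀⟩ := exists_norm_sub_le_of_embedding he hinj hinj' hg₀
  choose L hL h using fun i => exists_norm_sub_le_of_embedding he hinj hinj' (hg i)
  refine ⟨L₀ + ∑ i, R * L i,
    add_nonneg hL₀ (Finset.sum_nonneg fun i _ => mul_nonneg hR0.le (hL i)), fun v hv x y => ?_⟩
  have hsub : affineField g₀ g v x - affineField g₀ g v y =
      (g₀ x - g₀ y) + ∑ i, v i • (g i x - g i y) := by
    simp only [affineField, smul_sub, Finset.sum_sub_distrib]
    abel
  rw [hsub, add_mul, Finset.sum_mul]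
  refine (norm_add_le _ _).trans (add_le_add (h₀ x y) ?_)
  refine (norm_sum_le _ _).trans (Finset.sum_le_sum fun i _ => ?_)
  rw [norm_smul, mul_assoc]
  exact mul_le_mul ((PiLp.norm_apply_le v i).trans (hR v hv)) (h i x y) (norm_nonneg _) hR0.le

variable {k : ℕ} {A : Set (EuclideanSpace ℝ (Fin k))}

theorem continuous_section_of_contMDiffOn [IsManifold (𝓡 n) ∞ M]
    {f : EuclideanSpace ℝ (Fin k) → (x : M) → TangentSpace (𝓡 n) x}
    (hf : ContMDiffOn (𝓘(ℝ, EuclideanSpace ℝ (Fin k)).prod (𝓡 n)) (𝓡 n).tangent ∞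
      (fun p : EuclideanSpace ℝ (Fin k) × M =>
        (⟨p.2, f p.1 p.2⟩ : TangentBundle (𝓡 n) M)) (A ×ˢ univ)) :
    Continuous fun p : A × M => (⟨p.2, f p.1 p.2⟩ : TangentBundle (𝓡 n) M) :=
  hf.continuousOn.comp_continuous (f := fun p : A × M => ((p.1 : EuclideanSpace ℝ (Fin k)), p.2))
    (by fun_prop) fun p => ⟨p.1.2, trivial⟩

theorem contMDiff_section_of_contMDiffOn [IsManifold (𝓡 n) ∞ M]
    {f : EuclideanSpace ℝ (Fin k) → (x : M) → TangentSpace (𝓡 n) x}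
    (hf : ContMDiffOn (𝓘(ℝ, EuclideanSpace ℝ (Fin k)).prod (𝓡 n)) (𝓡 n).tangent ∞
      (fun p : EuclideanSpace ℝ (Fin k) × M =>
        (⟨p.2, f p.1 p.2⟩ : TangentBundle (𝓡 n) M)) (A ×ˢ univ)) (α : A) :
    ContMDiff (𝓡 n) (𝓡 n).tangent ∞ fun x => (⟨x, f α x⟩ : TangentBundle (𝓡 n) M) := by
  rw [← contMDiffOn_univ]
  exact hf.comp (f := fun x : M => ((α : EuclideanSpace ℝ (Fin k)), x))
    (contMDiff_const.prodMk contMDiff_id).contMDiffOn fun x _ => ⟨α.2, trivial⟩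

/-- The transition maps satisfy the flow property over the shift and are continuous in all
variables. -/
theorem transitionMap_add_and_continuous [T2Space M] [IsManifold (𝓡 n) ∞ M] [CompactSpace M]
    [tU : TopologicalSpace (ControlFunction U)] (htU : tU = weakStarTopology U) (hU : IsCompact U)
    {f₀ : EuclideanSpace ℝ (Fin k) → (x : M) → TangentSpace (𝓡 n) x}
    {f : Fin m → EuclideanSpace ℝ (Fin k) → (x : M) → TangentSpace (𝓡 n) x}
    (hf₀ : ContMDiffOn (𝓘(ℝ, EuclideanSpace ℝ (Fin k)).prod (𝓡 n)) (𝓡 n).tangent ∞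
      (fun p : EuclideanSpace ℝ (Fin k) × M =>
        (⟨p.2, f₀ p.1 p.2⟩ : TangentBundle (𝓡 n) M)) (A ×ˢ univ))
    (hf : ∀ i, ContMDiffOn (𝓘(ℝ, EuclideanSpace ℝ (Fin k)).prod (𝓡 n)) (𝓡 n).tangent ∞
      (fun p : EuclideanSpace ℝ (Fin k) × M =>
        (⟨p.2, f i p.1 p.2⟩ : TangentBundle (𝓡 n) M)) (A ×ˢ univ))
    (hcomplete : ∀ α : A, IsCompleteSystem U (f₀ α) (fun i => f i α)) :
    (∀ (α : A) (t s : ℝ) (x : M) (u : ControlFunction U),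
      transitionMap (f₀ α) (fun i => f i α) (t + s) x u =
        transitionMap (f₀ α) (fun i => f i α) s (transitionMap (f₀ α) (fun i => f i α) t x u)
          (shift t u)) ∧
    Continuous fun p : ℝ × A × (ControlFunction U × M) =>
      transitionMap (f₀ p.2.1) (fun i => f i p.2.1) p.1 p.2.2.2 p.2.2.1 := by
  obtain ⟨N, e, he, hemb, hinj'⟩ := exists_embedding_euclidean_of_compact (I := 𝓡 n) (M := M)
  have hinj := hemb.injective
  have hc₀ := continuous_pushField he (v := fun α : A => f₀ α)
    (continuous_section_of_contMDiffOn hf₀)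
  have hc := fun i => continuous_pushField he (v := fun α : A => f i α)
    (continuous_section_of_contMDiffOn (hf i))
  have hL := fun α : A => exists_lipschitz_affineField hU he hinj hinj'
    (contMDiff_pushField he (contMDiff_section_of_contMDiffOn hf₀ α))
    (fun i => contMDiff_pushField he (contMDiff_section_of_contMDiffOn (hf i) α))
  have hsol : ∀ (α : A) x u, IsIntegralSolution e
      (affineField (pushField e (f₀ α)) fun i => pushField e (f i α)) u
      fun t => transitionMap (f₀ α) (fun i => f i α) t x u := fun α x u =>
    (isSolution_transitionMap (hcomplete α) x u).1.isIntegralSolution hU he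
      (hc₀.comp (Continuous.prodMk_right α)) fun i => (hc i).comp (Continuous.prodMk_right α)
  have h0 : ∀ (α : A) x u, transitionMap (f₀ α) (fun i => f i α) 0 x u = x := fun α x u =>
    (isSolution_transitionMap (hcomplete α) x u).2
  refine ⟨fun α t s x u => ?_, ?_⟩
  · obtain ⟨L, hL0, hL⟩ := hL α
    have hV : Continuous fun q : EuclideanSpace ℝ (Fin m) × M =>
        affineField (pushField e (f₀ α)) (fun i => pushField e (f i α)) q.1 q.2 := by
      have h1 : Continuous (pushField e (f₀ α)) := hc₀.comp (Continuous.prodMk_right α)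
      have h2 : ∀ i, Continuous (pushField e (f i α)) := fun i =>
        (hc i).comp (Continuous.prodMk_right α)
      unfold affineField
      fun_prop
    exact congrFun (((hsol α x u).shift t).eq_of_eq_zero hU he.continuous hinj hV hL0 hL
      (hsol α _ (shift t u)) (by simp [h0])) s
  · exact continuous_of_isIntegralSolution htU hU hemb.isEmbedding hc₀ hc hL hsol h0

end TransitionMap

/-! ### Lifts of chain control sets -/

section Lift

theorem controlLift_nonempty {𝒰 M : Type*} {φ : ℝ → M → 𝒰 → M} {E : Set M} (hne : E.Nonempty)
    (hE : IsFullTimeControlledInvariant φ E) : (controlLift φ E).Nonempty := by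
  obtain ⟨x, hx⟩ := hne
  obtain ⟨u, hu⟩ := hE x hx
  exact ⟨(u, x), hu⟩

variable {A 𝒰 M : Type*} [MetricSpace A] [MetricSpace 𝒰] [MetricSpace M]
  {φ : A → ℝ → M → 𝒰 → M} {E : A → Set M}

theorem isClosed_controlLift
    (hφ : Continuous fun p : ℝ × A × (𝒰 × M) => φ p.2.1 p.1 p.2.2.2 p.2.2.1) {α : A}
    (hE : IsClosed (E α)) : IsClosed (controlLift (φ α) (E α)) := by
  have : controlLift (φ α) (E α) = ⋂ t : ℝ, {z : 𝒰 × M | φ α t z.2 z.1 ∈ E α} := by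
    ext z
    simp [controlLift]
  rw [this]
  exact isClosed_iInter fun t => hE.preimage
    (hφ.comp (continuous_const.prodMk (continuous_const.prodMk continuous_id)))

/-- The lifts inherit upper semicontinuity: a point outside the lift over `α₀` leaves a neighbourhood
of `E α₀` at some time, and so do all nearby points for nearby parameters. -/
theorem SetUpperSemicontinuousAt.controlLift [CompactSpace 𝒰] [CompactSpace M]
    (hφ : Continuous fun p : ℝ × A × (𝒰 × M) => φ p.2.1 p.1 p.2.2.2 p.2.2.1) {α₀ : A}
    (hE : IsClosed (E α₀)) (husc : SetUpperSemicontinuousAt E α₀) {δ : ℝ} (hδ : 0 < δ) :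
    ∀ᶠ α in 𝓝 α₀, ∀ z ∈ controlLift (φ α) (E α),
      ∃ z' ∈ controlLift (φ α₀) (E α₀), dist z z' < δ := by
  have hK : IsCompact (Metric.thickening δ (ControlAffine.controlLift (φ α₀) (E α₀)))ᶜ :=
    Metric.isOpen_thickening.isClosed_compl.isCompact
  have hev : ∀ᶠ α in 𝓝 α₀, ∀ z ∈ (Metric.thickening δ (ControlAffine.controlLift (φ α₀) (E α₀)))ᶜ,
      z ∉ ControlAffine.controlLift (φ α) (E α) := by
    refine hK.eventually_forall_of_forall_eventually fun z hz => ?_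
    have hz' : z ∉ ControlAffine.controlLift (φ α₀) (E α₀) := fun h =>
      hz (Metric.self_subset_thickening hδ _ h)
    obtain ⟨t, ht⟩ : ∃ t, φ α₀ t z.2 z.1 ∉ E α₀ := by
      simpa [ControlAffine.controlLift] using hz'
    have hpos : 0 < Metric.infEDist (φ α₀ t z.2 z.1) (E α₀) := by
      rw [pos_iff_ne_zero]
      exact fun h => ht (by
        rwa [← hE.closure_eq, Metric.mem_closure_iff_infEDist_zero])
    obtain ⟨r, hr0, hr⟩ := ENNReal.lt_iff_exists_nnreal_btwn.1 hpos
    have hc : Continuous fun q : A × (𝒰 × M) =>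
        Metric.infEDist (φ q.1 t q.2.2 q.2.1) (E α₀) :=
      Metric.continuous_infEDist.comp (hφ.comp (continuous_const.prodMk continuous_id))
    have h1 := (hc.tendsto (α₀, z)).eventually_const_lt hr
    have h2 := husc.eventually_forall_infEDist_lt (ε := r) (by exact_mod_cast hr0)
    filter_upwards [h1, (continuous_fst.tendsto (α₀, z)).eventually h2] with q h3 h4 h5
    have h6 := h4 _ (h5 t)
    rw [ENNReal.ofReal_coe_nnreal] at h6
    exact lt_asymm h3 h6
  filter_upwards [hev] with α hα z hz
  by_contra h
  exact hα z (fun h' => h (Metric.mem_thickening_iff.1 h')) hz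

end Lift

end ControlAffine

theorem mainTheorem6 {n m k : ℕ} {M : Type*} [MetricSpace M] [CompactSpace M]
    [ChartedSpace (EuclideanSpace ℝ (Fin n)) M] [IsManifold (𝓡 n) ∞ M]
    [RiemannianBundle (fun x : M => TangentSpace (𝓡 n) x)]
    [IsContMDiffRiemannianBundle (𝓡 n) ∞ (EuclideanSpace ℝ (Fin n))
      (fun x : M => TangentSpace (𝓡 n) x)]
    [IsRiemannianManifold (𝓡 n) M]
    (U : Set (EuclideanSpace ℝ (Fin m))) (hUcompact : IsCompact U) (hUconvex : Convex ℝ U)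
    -- any metric on the space of controls that induces the weak* topology
    [dU : MetricSpace (ControlFunction U)]
    (hdU : dU.toUniformSpace.toTopologicalSpace = weakStarTopology U)
    (A : Set (EuclideanSpace ℝ (Fin k))) (hA : IsCompact A)
    (f₀ : EuclideanSpace ℝ (Fin k) → (x : M) → TangentSpace (𝓡 n) x)
    (f : Fin m → EuclideanSpace ℝ (Fin k) → (x : M) → TangentSpace (𝓡 n) x)
    (hf₀ : ContMDiffOn (𝓘(ℝ, EuclideanSpace ℝ (Fin k)).prod (𝓡 n)) (𝓡 n).tangent ∞
      (fun p : EuclideanSpace ℝ (Fin k) × M =>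
        (⟨p.2, f₀ p.1 p.2⟩ : TangentBundle (𝓡 n) M)) (A ×ˢ univ))
    (hf : ∀ i, ContMDiffOn (𝓘(ℝ, EuclideanSpace ℝ (Fin k)).prod (𝓡 n)) (𝓡 n).tangent ∞
      (fun p : EuclideanSpace ℝ (Fin k) × M =>
        (⟨p.2, f i p.1 p.2⟩ : TangentBundle (𝓡 n) M)) (A ×ˢ univ))
    (hcomplete : ∀ α : A, IsCompleteSystem U (f₀ α) (fun i => f i α))
    -- the transition maps, the control flows, the chain control sets and their lifts
    (φ : A → ℝ → M → ControlFunction U → M)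
    (hφ : φ = fun α : A => transitionMap (f₀ α) (fun i => f i α))
    (Φ : A → ℝ → ControlFunction U × M → ControlFunction U × M)
    (hΦ : Φ = fun α : A => controlFlow (f₀ α) (fun i => f i α))
    (E : A → Set M) (hEnonempty : ∀ α, (E α).Nonempty) (hEcompact : ∀ α, IsCompact (E α))
    (hE : ∀ α, IsChainControlSet (φ α) (E α))
    (α₀ : A) (hEusc : SetUpperSemicontinuousAt E α₀)
    (γ : A → ℝ → ControlFunction U × M → ℝ)
    (hγ : ∀ α, IsAdditiveCocycle (Φ α) (controlLift (φ α) (E α)) (γ α))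
    -- `(t, α, u, x) ↦ γ^α_t(u, x)` is continuous at all points over `α₀`
    (hγcont : ∀ (t : ℝ), ∀ z ∈ controlLift (φ α₀) (E α₀),
      ContinuousWithinAt (fun p : ℝ × A × (ControlFunction U × M) => γ p.2.1 p.1 p.2.2)
        {p | p.2.2 ∈ controlLift (φ p.2.1) (E p.2.1)} (t, α₀, z)) :
    -- the Morse spectra are nonempty and compact
    (∀ α, (morseSpectrum (Φ α) (controlLift (φ α) (E α)) (γ α)).Nonempty ∧
      IsCompact (morseSpectrum (Φ α) (controlLift (φ α) (E α)) (γ α))) ∧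
    -- the Morse spectrum is upper semicontinuous at `α₀`
    SetUpperSemicontinuousAt (fun α => morseSpectrum (Φ α) (controlLift (φ α) (E α)) (γ α)) α₀ ∧
    setLimsup (fun α => morseSpectrum (Φ α) (controlLift (φ α) (E α)) (γ α)) α₀ ⊆
      morseSpectrum (Φ α₀) (controlLift (φ α₀) (E α₀)) (γ α₀) ∧
    -- its infimum is lower semicontinuous at `α₀`
    LowerSemicontinuousAt
      (fun α => sInf (morseSpectrum (Φ α) (controlLift (φ α) (E α)) (γ α))) α₀ := by
  obtain ⟨hadd, hcont⟩ := transitionMap_add_and_continuous hdU hUcompact hf₀ hf hcomplete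
  have : CompactSpace (ControlFunction U) :=
    compactSpace_controlFunction hdU hUcompact hUconvex
  replace hadd : ∀ (α : A) t s x u, φ α (t + s) x u = φ α s (φ α t x u) (shift t u) := by
    rw [hφ]
    exact hadd
  replace hcont : Continuous fun p : ℝ × A × (ControlFunction U × M) =>
      φ p.2.1 p.1 p.2.2.2 p.2.2.1 := by
    rw [hφ]
    exact hcont
  have hΦφ : ∀ α t z, Φ α t z = (shift t z.1, φ α t z.2 z.1) := fun α t z => by
    rw [hΦ, hφ]
    rfl
  clear hΦ hφ
  have hΦcont : Continuous fun p : ℝ × A × (ControlFunction U × M) => Φ p.2.1 p.1 p.2.2 := by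
    simp only [hΦφ]
    exact ((continuous_shift hdU hUcompact).comp (continuous_fst.prodMk
      (continuous_fst.comp (continuous_snd.comp continuous_snd)))).prodMk hcont
  have hΦadd : ∀ α t s, ∀ z ∈ controlLift (φ α) (E α), Φ α (t + s) z = Φ α s (Φ α t z) :=
    fun α t s z _ => by simp only [hΦφ, shift_add, hadd]
  have hinv : ∀ α t, MapsTo (Φ α t) (controlLift (φ α) (E α)) (controlLift (φ α) (E α)) :=
    fun α t z hz s => by
      rw [hΦφ, ← hadd]
      exact hz (t + s)
  have hB : ∀ α, IsCompact (controlLift (φ α) (E α)) := fun α =>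
    (isClosed_controlLift hcont (hEcompact α).isClosed).isCompact
  have hspec := fun α => morseSpectrum_nonempty_and_isCompact (hB α)
    (controlLift_nonempty (hEnonempty α) (hE α).prop.1) (hinv α) (hΦadd α) (hγ α)
  have husc := setUpperSemicontinuousAt_morseSpectrum hΦcont (hB α₀) hinv hΦadd hγ hγcont
    fun δ hδ => hEusc.controlLift hcont (hEcompact α₀).isClosed hδ
  exact ⟨hspec, husc, husc.setLimsup_subset (hspec α₀).2.isClosed,
    husc.lowerSemicontinuousAt_sInf (fun α => (hspec α).1) fun α => (hspec α).2⟩
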